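/- Let $K$ be a field with separable closure $K^s$, and let $M$ be a smooth $K$-group of multiplicative type (for example, any $K$-group of multiplicative type if $\operatorname{char} K=0$, or a finite étale one, or a torus). Let $$1\to M\to F\to P\to 1$$ be a flasque resolution of $M$, i.e. an exact sequence of commutative affine algebraic $K$-groups in which * $F$ is a flasque torus: a torus whose cocharacter group $\check F$ satisfies $H^1(H,\check F)=0$ for every finite Galois extension $L|K$ splitting $F$ and every subgroup $H\subseteq \mathrm{Gal}(L|K)$; * $P$ is a quasi-trivial torus: a torus whose character group over $K^s$ has a $\mathbb Z$-basis permuted by $\mathrm{Gal}(K^s|K)$. Let $T$ be a finite set of (normalized, pairwise distinct) discrete valuations of $K$, and for $v\in T$ let $K_v$ be the completion of $K$ with respect to $v$. For a field $L\supseteq K$ and a commutative $K$-group $G$ write $H^1(L,G)=H^1(\mathrm{Gal}(L^s|L),G(L^s))$ for continuous Galois cohomology, with $G(L^s)$ discrete. Then the map $M\to F$ induces an isomorphism $$ \mathrm{Coker}\Bigl(H^1(K, M)\to\prod_{v\in T} H^1(K_v,M)\Bigr)\;\xrightarrow{\ \sim\ }\; \mathrm{Coker}\Bigl(H^1(K,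 F)\to \prod_{v\in T} H^1(K_v,F)\Bigr), $$ where the maps from $H^1(K,-)$ are the products of the restriction maps (formed with arbitrary $K$-embeddings $K^s\to K_v^s$). -/

import Mathlib

open scoped TensorProduct WithZero
open WithConv

noncomputable section

namespace FlasqueGW

universe u v w

/-! ### Points of affine commutative group schemes

An affine commutative group scheme over `K` is given by its coordinate ring, a commutative and
cocommutative Hopf algebra `A` over `K`. -/

section Points

variable (K : Type u) [Field K] (A : Type v) [CommRing A] [HopfAlgebra K A]

/-- The set `M(R)` of `R`-valued points of the affine `K`-group `M = Spec A`. -/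
def Points (R : Type w) [CommRing R] [Algebra K R] := WithConv (A →ₐ[K] R)

variable [Coalgebra.IsCocomm K A] (R : Type w) [CommRing R] [Algebra K R]

instance : CommMonoid (Points K A R) := inferInstanceAs (CommMonoid (WithConv (A →ₐ[K] R)))

/-- The group structure on `M(R)`: convolution, with inverse given by the antipode. -/
instance : CommGroup (Points K A R) where
  inv f := toConv (f.ofConv.comp (HopfAlgebra.antipodeAlgHom K A))
  inv_mul_cancel f := by
    have h : f.ofConv.comp (toConv (HopfAlgebra.antipodeAlgHom K A) *
        toConv (AlgHom.id K A)).ofConv = _ :=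
      AlgHom.comp_convMul_distrib f.ofConv _ _
    rw [AlgHom.antipode_id_cancel] at h
    refine (WithConv.ext h).symm.trans ?_
    apply WithConv.ext
    ext a
    change f.ofConv (algebraMap K A (Coalgebra.counit a)) = algebraMap K R (Coalgebra.counit a)
    simp

variable {R}

/-- A homomorphism of `K`-algebras `R → S` induces a homomorphism `M(R) → M(S)`. -/
def Points.map {S : Type*} [CommRing S] [Algebra K S] (φ : R →ₐ[K] S) :
    Points K A R →* Points K A S where
  toFun f := toConv (φ.comp f.ofConv)
  map_one' := by
    apply WithConv.ext
    ext a
    change φ (algebraMap K R (Coalgebra.counit a)) = algebraMap K S (Coalgebra.counit a)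
    simp
  map_mul' f g := WithConv.ext (AlgHom.comp_convMul_distrib φ f g)

variable {A} (R)

/-- A homomorphism of `K`-groups `M → N`, given by the homomorphism of Hopf algebras `h` in the
opposite direction, induces a homomorphism `M(R) → N(R)`. -/
def Points.comap {B : Type*} [CommRing B] [HopfAlgebra K B] [Coalgebra.IsCocomm K B]
    (h : B →ₐc[K] A) : Points K A R →* Points K B R where
  toFun f := toConv (f.ofConv.comp (h : B →ₐ[K] A))
  map_one' := by
    apply WithConv.ext
    ext b
    change algebraMap K R (Coalgebra.counit (h b)) = algebraMap K R (Coalgebra.counit b)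
    simp
  map_mul' f g := WithConv.ext (AlgHom.convMul_comp_bialgHom_distrib f g h)

variable (A)

/-- For a field extension `E / L` over `K`, the group `Gal(E/L)` acts on `M(E)`. -/
instance (L E : Type*) [Field L] [Field E] [Algebra K L] [Algebra L E] [Algebra K E]
    [IsScalarTower K L E] : MulDistribMulAction Gal(E/L) (Points K A E) where
  smul σ f := Points.map K A ((σ : E →ₐ[L] E).restrictScalars K) f
  one_smul _ := rfl
  mul_smul _ _ _ := rfl
  smul_one σ := map_one (Points.map K A ((σ : E →ₐ[L] E).restrictScalars K))
  smul_mul σ := map_mul (Points.map K A ((σ : E →ₐ[L] E).restrictScalars K))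

theorem Points.smul_def (L E : Type*) [Field L] [Field E] [Algebra K L] [Algebra L E] [Algebra K E]
    [IsScalarTower K L E] (σ : Gal(E/L)) (f : Points K A E) :
    σ • f = Points.map K A ((σ : E →ₐ[L] E).restrictScalars K) f := rfl

end Points

/-! ### First cohomology groups -/

section H1

open groupCohomology

variable (G : Type u) [Group G] [TopologicalSpace G] (M : Type v) [CommGroup M]
  [MulDistribMulAction G M]

/-- Continuous `1`-cocycles of `G` with values in the discrete `G`-module `M`. -/
def Z1 : Subgroup (G → M) where
  carrier := {f | IsMulCocycle₁ f ∧ IsLocallyConstant f}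
  one_mem' := ⟨fun _ _ ↦ by simp, IsLocallyConstant.const 1⟩
  mul_mem' := by
    rintro f g ⟨hf, hf'⟩ ⟨hg, hg'⟩
    refine ⟨fun x y ↦ ?_, hf'.mul hg'⟩
    simp only [Pi.mul_apply, hf x y, hg x y, smul_mul']
    exact mul_mul_mul_comm _ _ _ _
  inv_mem' := by
    rintro f ⟨hf, hf'⟩
    refine ⟨fun x y ↦ ?_, hf'.inv⟩
    simp only [Pi.inv_apply, hf x y, smul_inv', mul_inv]

/-- The subgroup of `1`-coboundaries `g ↦ g • x / x`. -/
def B1 : Subgroup (Z1 G M) where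
  carrier := {f | IsMulCoboundary₁ f.1}
  one_mem' := ⟨1, fun g ↦ by simp⟩
  mul_mem' := by
    rintro f g ⟨x, hx⟩ ⟨y, hy⟩
    refine ⟨x * y, fun s ↦ ?_⟩
    simp only [smul_mul', Subgroup.coe_mul, Pi.mul_apply, ← hx s, ← hy s]
    exact mul_div_mul_comm _ _ _ _
  inv_mem' := by
    rintro f ⟨x, hx⟩
    refine ⟨x⁻¹, fun s ↦ ?_⟩
    simp only [smul_inv', InvMemClass.coe_inv, Pi.inv_apply, ← hx s, inv_div_inv, inv_div]

/-- The continuous cohomology group `H¹(G, M)` of the discrete `G`-module `M`. -/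
def H1 := Z1 G M ⧸ B1 G M

instance : CommGroup (H1 G M) := inferInstanceAs (CommGroup (Z1 G M ⧸ B1 G M))

variable {G M} {G' : Type*} [Group G'] [TopologicalSpace G'] {M' : Type*} [CommGroup M']
  [MulDistribMulAction G' M']

/-- The map on cocycles induced by compatible homomorphisms `G' → G` and `M → M'`. -/
def Z1.map (φ : G' →ₜ* G) (ψ : M →* M') (h : ∀ g m, ψ (φ g • m) = g • ψ m) :
    Z1 G M →* Z1 G' M' where
  toFun f := ⟨fun g ↦ ψ (f.1 (φ g)), fun x y ↦ by
    simp only [map_mul, f.2.1 (φ x) (φ y), h],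
    (f.2.2.comp_continuous φ.continuous_toFun).comp ψ⟩
  map_one' := by ext; exact map_one ψ
  map_mul' f g := by ext; exact map_mul ψ _ _

/-- The map `H¹(G, M) → H¹(G', M')` induced by compatible homomorphisms `G' → G` and `M → M'`. -/
def H1.map (φ : G' →ₜ* G) (ψ : M →* M') (h : ∀ g m, ψ (φ g • m) = g • ψ m) :
    H1 G M →* H1 G' M' :=
  QuotientGroup.map _ _ (Z1.map φ ψ h) (by
    rintro f ⟨x, hx⟩
    refine ⟨ψ x, fun g ↦ ?_⟩
    change g • ψ x / ψ x = ψ (f.1 (φ g))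
    rw [← hx, map_div, h])

end H1

/-! ### Galois cohomology of affine commutative groups -/

section GaloisCohomology

/-- An embedding `ι : E → Ω` over `K` of a normal extension `E / K` into an extension `Ω` of a field
`L ⊇ K` induces a continuous restriction homomorphism `Gal(Ω/L) → Gal(E/K)`, given by
`ι (galRes ι σ x) = σ (ι x)`. -/
def galRes {K L E Ω : Type*} [Field K] [Field L] [Field E] [Field Ω] [Algebra K L] [Algebra K E]
    [Algebra L Ω] [Algebra K Ω] [IsScalarTower K L Ω] [Normal K E] (ι : E →ₐ[K] Ω) :
    Gal(Ω/L) →ₜ* Gal(E/K) :=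
  letI : Algebra E Ω := ι.toAlgebra
  haveI : IsScalarTower K E Ω := .of_algebraMap_eq fun x ↦ (ι.commutes x).symm
  { toMonoidHom := (AlgEquiv.restrictNormalHom E).comp (AlgEquiv.restrictScalarsHom K)
    continuous_toFun := by
      apply continuous_of_continuousAt_one
        ((AlgEquiv.restrictNormalHom E).comp (AlgEquiv.restrictScalarsHom K) :
          Gal(Ω/L) →* Gal(E/K)) (continuousAt_def.mpr _)
      intro N hN
      rw [map_one, krullTopology_mem_nhds_one_iff] at hN
      obtain ⟨F, hF, hFN⟩ := hN
      obtain ⟨s, hs⟩ := (IntermediateField.essFiniteType_iff.mp inferInstance : F.FG)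
      rw [krullTopology_mem_nhds_one_iff]
      refine ⟨IntermediateField.adjoin L (ι '' s), ?_, fun σ hσ ↦ hFN ?_⟩
      · apply IntermediateField.finiteDimensional_adjoin
        rintro _ ⟨x, -, rfl⟩
        exact ((Algebra.IsIntegral.isIntegral (R := K) x).map ι).tower_top
      · have key : ∀ x, ι (AlgEquiv.restrictNormalHom E (σ.restrictScalars K) x) = σ (ι x) :=
          fun x ↦ AlgEquiv.restrictNormal_commutes (σ.restrictScalars K) E x
        rw [SetLike.mem_coe, IntermediateField.mem_fixingSubgroup_iff, ← hs]
        rw [SetLike.mem_coe, IntermediateField.mem_fixingSubgroup_iff] at hσ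
        intro x hx
        induction hx using IntermediateField.adjoin_induction with
        | mem x hx =>
          apply ι.injective
          exact (key x).trans (hσ _ (IntermediateField.subset_adjoin _ _ ⟨x, hx, rfl⟩))
        | algebraMap x => exact AlgEquiv.commutes _ x
        | add x y _ _ hx hy => rw [map_add, hx, hy]
        | inv x _ hx => rw [map_inv₀, hx]
        | mul x y _ _ hx hy => rw [map_mul, hx, hy] }

theorem galRes_apply {K L E Ω : Type*} [Field K] [Field L] [Field E] [Field Ω] [Algebra K L]
    [Algebra K E] [Algebra L Ω] [Algebra K Ω] [IsScalarTower K L Ω] [Normal K E] (ι : E →ₐ[K] Ω)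
    (σ : Gal(Ω/L)) (x : E) : ι (galRes ι σ x) = σ (ι x) :=
  letI : Algebra E Ω := ι.toAlgebra
  haveI : IsScalarTower K E Ω := .of_algebraMap_eq fun x ↦ (ι.commutes x).symm
  AlgEquiv.restrictNormal_commutes (σ.restrictScalars K) E x

variable (K : Type u) [Field K] (A : Type v) [CommRing A] [HopfAlgebra K A]
  [Coalgebra.IsCocomm K A]

/-- The Galois cohomology group `H¹(L, M) = H¹(Gal(Lˢ/L), M(Lˢ))` of the `K`-group `M = Spec A` over
an extension field `L` of `K`. -/
def GalH1 (L : Type*) [Field L] [Algebra K L] :=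
  H1 Gal(SeparableClosure L/L) (Points K A (SeparableClosure L))

instance (L : Type*) [Field L] [Algebra K L] : CommGroup (GalH1 K A L) :=
  inferInstanceAs (CommGroup (H1 Gal(SeparableClosure L/L) (Points K A (SeparableClosure L))))

/-- The restriction map `H¹(K, M) → H¹(L, M)` for a field extension `L / K`, computed with the
embedding `ι : Kˢ → Lˢ`. -/
def GalH1.res (L : Type*) [Field L] [Algebra K L]
    (ι : SeparableClosure K →ₐ[K] SeparableClosure L) : GalH1 K A K →* GalH1 K A L :=
  H1.map (galRes ι) (Points.map K A ι) (by
    intro σ f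
    exact WithConv.ext (AlgHom.ext fun a ↦ galRes_apply ι σ (f.ofConv a)))

variable {A}

/-- The map `H¹(L, M) → H¹(L, N)` induced by a homomorphism of `K`-groups `M → N`. -/
def GalH1.push {B : Type*} [CommRing B] [HopfAlgebra K B] [Coalgebra.IsCocomm K B]
    (h : B →ₐc[K] A) (L : Type*) [Field L] [Algebra K L] : GalH1 K A L →* GalH1 K B L :=
  H1.map (.id _) (Points.comap K (SeparableClosure L) h) (fun _ _ ↦ rfl)

end GaloisCohomology

/-! ### Groups of multiplicative type and tori -/

section MultiplicativeType

variable (K : Type u) [Field K] (A : Type v) [CommRing A] [HopfAlgebra K A]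

/-- `Spec A` is of multiplicative type: over `Kˢ` it becomes isomorphic to the diagonalizable group
`Spec Kˢ[X]` of some finitely generated abelian group `X`. -/
def IsMultiplicativeType : Prop :=
  ∃ (X : Type) (_ : CommGroup X), Group.FG X ∧
    Nonempty ((SeparableClosure K ⊗[K] A) ≃ₐc[SeparableClosure K]
      MonoidAlgebra (SeparableClosure K) X)

/-- Over the extension field `L`, the group `Spec A` becomes isomorphic to a power of the
multiplicative group. -/
def IsSplitTorusOver (L : Type*) [Field L] [Algebra K L] : Prop :=
  ∃ n : ℕ, Nonempty ((L ⊗[K] A) ≃ₐc[L] MonoidAlgebra L (Multiplicative (Fin n → ℤ)))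

/-- `Spec A` is a torus over `K`. -/
def IsTorus : Prop := IsSplitTorusOver K A (SeparableClosure K)

/-- The character group of `Spec A` over `L`, whose elements are the group-like elements of
`L ⊗ A`, has a finite `ℤ`-basis that is permuted by `Gal(L/K)`. -/
def HasPermutationBasis (L : Type*) [Field L] [Algebra K L] : Prop :=
  ∃ (n : ℕ) (b : Module.Basis (Fin n) ℤ (Additive (GroupLike L (L ⊗[K] A)))),
    ∀ (σ : Gal(L/K)) (i : Fin n), ∃ j : Fin n,
      Algebra.TensorProduct.map (σ : L →ₐ[K] L) (AlgHom.id K A) (b i).toMul.val = (b j).toMul.val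

/-- `Spec A` is a quasi-trivial torus: its character group over `Kˢ` is a permutation module. -/
def IsQuasiTrivialTorus : Prop :=
  IsTorus K A ∧ HasPermutationBasis K A (SeparableClosure K)

variable [Coalgebra.IsCocomm K A] (L : Type w) [Field L] [Algebra K L]

/-- The group of cocharacters of `F = Spec A` over `L`. A morphism of `L`-schemes `𝔾ₘ → F` is a point
`f` of `F` with values in the ring `L[ℤ]` of Laurent polynomials `L[t, t⁻¹]`; it is a homomorphism
when `f(t₁ t₂) = f(t₁) f(t₂)` holds in `F(L[ℤ × ℤ])`, where `L[ℤ × ℤ]` is the ring of Laurent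
polynomials in `t₁` and `t₂`. -/
def cocharSubgroup : Subgroup (Points K A (AddMonoidAlgebra L ℤ)) :=
  (Points.map K A (AddMonoidAlgebra.mapDomainAlgHom K L
      ((AddMonoidHom.id ℤ).prod (AddMonoidHom.id ℤ)))).eqLocus
    (Points.map K A (AddMonoidAlgebra.mapDomainAlgHom K L (AddMonoidHom.inl ℤ ℤ)) *
      Points.map K A (AddMonoidAlgebra.mapDomainAlgHom K L (AddMonoidHom.inr ℤ ℤ)))

/-- The cocharacter group of `Spec A` over `L`. -/
abbrev Cochar := cocharSubgroup K A L

variable {L} in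
theorem mem_cocharSubgroup_map (σ : Gal(L/K)) {f : Points K A (AddMonoidAlgebra L ℤ)}
    (hf : f ∈ cocharSubgroup K A L) :
    Points.map K A (AddMonoidAlgebra.mapAlgHom ℤ (σ : L →ₐ[K] L)) f ∈ cocharSubgroup K A L := by
  have comm (g : ℤ →+ ℤ × ℤ) (f : Points K A (AddMonoidAlgebra L ℤ)) :
      Points.map K A (AddMonoidAlgebra.mapDomainAlgHom K L g)
        (Points.map K A (AddMonoidAlgebra.mapAlgHom ℤ (σ : L →ₐ[K] L)) f) =
      Points.map K A (AddMonoidAlgebra.mapAlgHom (ℤ × ℤ) (σ : L →ₐ[K] L))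
        (Points.map K A (AddMonoidAlgebra.mapDomainAlgHom K L g) f) := by
    have : (AddMonoidAlgebra.mapDomainAlgHom K L g).comp
        (AddMonoidAlgebra.mapAlgHom ℤ (σ : L →ₐ[K] L)) =
        (AddMonoidAlgebra.mapAlgHom (ℤ × ℤ) (σ : L →ₐ[K] L)).comp
          (AddMonoidAlgebra.mapDomainAlgHom K L g) := by
      apply AddMonoidAlgebra.algHom_ext
      · intro m
        rw [AlgHom.comp_apply, AlgHom.comp_apply, AddMonoidAlgebra.mapAlgHom_single]
        simp only [AddMonoidAlgebra.mapDomainAlgHom_apply, AddMonoidAlgebra.mapDomain_single]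
        rw [AddMonoidAlgebra.mapAlgHom_single]
      · refine AlgHom.ext fun x ↦ ?_
        simp only [AlgHom.comp_apply, AddMonoidAlgebra.singleZeroAlgHom_apply]
        rw [AddMonoidAlgebra.mapAlgHom_single]
        simp only [AddMonoidAlgebra.mapDomainAlgHom_apply, AddMonoidAlgebra.mapDomain_single]
        rw [AddMonoidAlgebra.mapAlgHom_single]
    exact WithConv.ext (congrArg (fun h ↦ h.comp f.ofConv) this)
  have mem (f : Points K A (AddMonoidAlgebra L ℤ)) : f ∈ cocharSubgroup K A L ↔
      Points.map K A (AddMonoidAlgebra.mapDomainAlgHom K L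
        ((AddMonoidHom.id ℤ).prod (AddMonoidHom.id ℤ))) f =
      Points.map K A (AddMonoidAlgebra.mapDomainAlgHom K L (AddMonoidHom.inl ℤ ℤ)) f *
      Points.map K A (AddMonoidAlgebra.mapDomainAlgHom K L (AddMonoidHom.inr ℤ ℤ)) f := Iff.rfl
  rw [mem] at hf ⊢
  rw [comm, comm, comm, hf, map_mul]

/-- The Galois group acts on cocharacters through its action on the coefficients of `L[ℤ]`. -/
instance : MulDistribMulAction Gal(L/K) (Cochar K A L) where
  smul σ f := ⟨Points.map K A (AddMonoidAlgebra.mapAlgHom ℤ (σ : L →ₐ[K] L)) f.1,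
    mem_cocharSubgroup_map K A σ f.2⟩
  one_smul f := by
    apply Subtype.ext
    apply WithConv.ext
    change (AddMonoidAlgebra.mapAlgHom ℤ (AlgHom.id K L)).comp _ = _
    rw [AddMonoidAlgebra.mapAlgHom_id, AlgHom.id_comp]
  mul_smul σ τ f := by
    apply Subtype.ext
    apply WithConv.ext
    change (AddMonoidAlgebra.mapAlgHom ℤ ((σ : L →ₐ[K] L).comp (τ : L →ₐ[K] L))).comp _ = _
    rw [AddMonoidAlgebra.mapRangeAlgHom_comp, AlgHom.comp_assoc]
    rfl
  smul_one σ := Subtype.ext (map_one (Points.map K A _))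
  smul_mul σ f g := Subtype.ext (map_mul (Points.map K A _) f.1 g.1)

open groupCohomology in
/-- `Spec A` is a flasque torus: for every finite Galois extension `L / K` that splits it and every
subgroup `H` of `Gal(L/K)`, the group `H¹(H, Cochar)` vanishes, that is, every `1`-cocycle is a
coboundary. -/
def IsFlasqueTorus : Prop :=
  IsTorus K A ∧
    ∀ L : IntermediateField K (SeparableClosure K), FiniteDimensional K L → IsGalois K L →
      IsSplitTorusOver K A L → ∀ H : Subgroup Gal(L/K), ∀ c : H → Cochar K A L,
        IsMulCocycle₁ c → IsMulCoboundary₁ c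

end MultiplicativeType

/-- The sequence of affine `K`-groups `1 → Spec A → Spec B → Spec C → 1` attached to homomorphisms
of Hopf algebras `q : C → B` and `i : B → A` is exact: `Spec B → Spec C` is faithfully flat, and
`Spec A → Spec B` is a closed immersion onto its kernel, the closed subgroup defined by the ideal
of `B` generated by the augmentation ideal of `C`. -/
structure IsShortExact {K : Type*} [Field K] {A B C : Type*} [CommRing A] [CommRing B] [CommRing C]
    [HopfAlgebra K A] [HopfAlgebra K B] [HopfAlgebra K C]
    (i : B →ₐc[K] A) (q : C →ₐc[K] B) : Prop where
  surjective : Function.Surjective i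
  ker_eq : RingHom.ker (i : B →ₐ[K] A) =
    (RingHom.ker (Bialgebra.counitAlgHom K C)).map (q : C →ₐ[K] B)
  faithfullyFlat : ((q : C →ₐ[K] B) : C →+* B).FaithfullyFlat

/-- `1 → Spec A → Spec B → Spec C → 1` is a flasque resolution of the group of multiplicative type
`Spec A`. -/
structure IsFlasqueResolution {K : Type*} [Field K] {A B C : Type*} [CommRing A] [CommRing B]
    [CommRing C] [HopfAlgebra K A] [HopfAlgebra K B] [HopfAlgebra K C] [Coalgebra.IsCocomm K B]
    (i : B →ₐc[K] A) (q : C →ₐc[K] B) : Prop where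
  multiplicativeType : IsMultiplicativeType K A
  flasque : IsFlasqueTorus K B
  quasiTrivial : IsQuasiTrivialTorus K C
  exact : IsShortExact i q

/-! ### Localization -/

section Localization

variable {K : Type u} [Field K]

/-- The completion `K_v` of `K` with respect to the valuation `v`. -/
def CompletionAt (v : Valuation K ℤᵐ⁰) := v.Completion

instance (v : Valuation K ℤᵐ⁰) : Field (CompletionAt v) := inferInstanceAs (Field v.Completion)

/-- The embedding of `K` into its completion at `v`. -/
instance (v : Valuation K ℤᵐ⁰) : Algebra K (CompletionAt v) :=
  RingHom.toAlgebra ((UniformSpace.Completion.coeRingHom (α := WithVal v)).comp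
    (WithVal.equiv v).symm.toRingHom : K →+* v.Completion)

variable (A : Type v) [CommRing A] [HopfAlgebra K A] [Coalgebra.IsCocomm K A]
  (T : Finset (Valuation K ℤᵐ⁰))
  (ι : ∀ v : T, SeparableClosure K →ₐ[K] SeparableClosure (CompletionAt v.1))

/-- The map `H¹(K, M) → ∏_{v ∈ T} H¹(K_v, M)`. -/
def localization : GalH1 K A K →* ∀ v : T, GalH1 K A (CompletionAt v.1) :=
  MonoidHom.pi fun v ↦ GalH1.res K A (CompletionAt v.1) (ι v)

/-- The cokernel of `H¹(K, M) → ∏_{v ∈ T} H¹(K_v, M)`. -/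
abbrev LocCoker := (∀ v : T, GalH1 K A (CompletionAt v.1)) ⧸ (localization A T ι).range

/-- The projection from `∏_{v ∈ T} H¹(K_v, M)` to the cokernel. -/
def LocCoker.proj : (∀ v : T, GalH1 K A (CompletionAt v.1)) →* LocCoker A T ι :=
  QuotientGroup.mk' _

end Localization

end FlasqueGW

end

/-!
Write `M`, `F`, `P` for the groups `Spec A`, `Spec B`, `Spec C`. The statement follows from the
long exact cohomology sequences over `K` and over the completions `K_v`, from the vanishing of
`H¹(L, P)` for every extension field `L` of `K`, and from an approximation property: rational points
of `P` over the `K_v`, for `v` in the finite set `T`, are simultaneously approximated by a point of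
`P(K)` up to the images of the groups `F(K_v)`.

*Exactness.* Points of a diagonalizable group are homomorphisms on its character group
(`charEval_bijective`), so everything is expressed through the character groups of `F` and `P` over
`Kˢ`. Since `M` is smooth, its coordinate ring is geometrically reduced, hence the cokernel of the
injection of the characters of `P` into those of `F` has no `p`-torsion in characteristic `p`. There
is therefore a retraction up to multiplication by an integer `d` invertible in `K`
(`IsShortExact.exists_almost_retraction`). It turns `d`-th powers of points of `P` into images of
points of `F`, so `F(Ω) → P(Ω)` is surjective for separably closed `Ω`.

*Vanishing.* The points of `P` form a permutation module of units, whose first cohomology vanishes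
by Hilbert's theorem 90 (`IsPermBasis.isMulCoboundary`). In particular `H¹(L, M) → H¹(L, F)` is
surjective, and so is the map of cokernels. For injectivity one must write a family of classes of
`H¹(K_v, M)` that die in `H¹(K_v, F)`, thus come from `P(K_v)`, as the localization of a class
coming from `P(K)` (`IsDiscreteExact.exists_map_eq`); this is where approximation enters.

*Approximation.* A point of `P(K_v)` close to `1` lifts to `F(K_v)`
(`exists_fixed_lift_of_near_one`): over a finite Galois extension, the norm of `(1 + a x) ^ d` with
`a` of trace `1` has derivative `d ≠ 0` at `x = 0`, so the inverse function theorem writes such a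
point as the norm of a `d`-th power, which the almost retraction lifts. By Galois descent the
coordinates of rational points of `P` vary in an affine space over the ground field
(`exists_fixed_basis`, `exists_coords_of_fixed`), where weak approximation for the pairwise
distinct valuations in `T` (`exists_near_of_valuations`) applies.
-/

noncomputable section

namespace FlasqueGW

universe u

/-! ### Smooth algebras over a field are reduced -/

open Polynomial in
/-- For nilpotent `a`, the element `a ⊗ X` of `A ⊗ k[X]` is integral over `A`. Integral closure
commutes with smooth base change, and the integral closure of `k` in `k[X]` consists of constants,
so the coefficient `a` of `X` vanishes. -/
theorem isReduced_of_smooth (k A : Type*) [Field k] [CommRing A] [Algebra k A]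
    [Algebra.Smooth k A] : IsReduced A := by
  refine ⟨fun a ha ↦ ?_⟩
  have hint : IsIntegral A (a ⊗ₜ[k] (X : k[X])) := by
    obtain ⟨n, hn⟩ := ha
    refine IsIntegral.of_pow (n := n + 1) n.succ_pos ?_
    rw [Algebra.TensorProduct.tmul_pow, pow_succ, hn, zero_mul, TensorProduct.zero_tmul]
    exact isIntegral_zero
  obtain ⟨y, hy⟩ := (TensorProduct.toIntegralClosure_bijective_of_smooth
    (R := k) (S := A) (B := k[X])).2 ⟨_, hint⟩
  have hy' := congrArg Subtype.val hy
  change Algebra.TensorProduct.map (.id _ _) (integralClosure k k[X]).val y = _ at hy'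
  -- A polynomial that is algebraic over `k` is constant.
  have hcoeff : ∀ z : integralClosure k k[X], (z : k[X]).coeff 1 = 0 := by
    intro z
    by_contra hz
    refine Polynomial.transcendental (z : k[X]) (fun h ↦ hz ?_) ?_ z.2.isAlgebraic
    · exact coeff_eq_zero_of_natDegree_lt (by omega)
    · exact mem_nonZeroDivisors_of_ne_zero (leadingCoeff_ne_zero.2 fun h ↦ hz (by simp [h]))
  have key : ∀ y, (lcoeff k 1).lTensor A ((Algebra.TensorProduct.map (.id A A)
      (integralClosure k k[X]).val) y) = 0 := by
    intro y
    induction y with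
    | zero => simp
    | add x y hx hy => rw [map_add, map_add, hx, hy, add_zero]
    | tmul x y => simp [hcoeff]
  have key := key y
  rw [hy'] at key
  simpa using congrArg (TensorProduct.rid k A) key

/-! ### Evaluation of characters at points -/

section Evaluation
variable {K : Type*} [Field K] {B : Type*} [CommRing B] [HopfAlgebra K B]
  {E : Type*} [Field E] [Algebra K E] {Ω : Type*} [Field Ω] [Algebra K Ω]
/-- The homomorphism `E ⊗ B → Ω` attached to an embedding `ι : E → Ω` over `K` and a point `f` of
`Spec B` with values in `Ω`. On a group-like element, that is, a character of `Spec B` over `E`, it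
is the value of this character at `f`. -/
def evalAt (ι : E →ₐ[K] Ω) (f : Points K B Ω) : E ⊗[K] B →ₐ[K] Ω :=
  Algebra.TensorProduct.productMap ι f.ofConv
theorem evalAt_tmul (ι : E →ₐ[K] Ω) (f : Points K B Ω) (s : E) (b : B) :
    evalAt ι f (s ⊗ₜ b) = ι s * f.ofConv b :=
  Algebra.TensorProduct.productMap_apply_tmul ..
theorem evalAt_smul (ι : E →ₐ[K] Ω) (f : Points K B Ω) (s : E) (x : E ⊗[K] B) :
    evalAt ι f (s • x) = ι s * evalAt ι f x := by
  rw [Algebra.smul_def, map_mul, Algebra.TensorProduct.algebraMap_apply, evalAt_tmul]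
  simp
theorem evalAt_injective (ι : E →ₐ[K] Ω) :
    Function.Injective (evalAt (B := B) ι) := by
  intro f g h
  refine WithConv.ext (AlgHom.ext fun b ↦ ?_)
  simpa [evalAt_tmul] using DFunLike.congr_fun h (1 ⊗ₜ b)
theorem evalAt_map [Coalgebra.IsCocomm K B] (ι : E →ₐ[K] Ω) {Ω' : Type*} [Field Ω']
    [Algebra K Ω'] (j : Ω →ₐ[K] Ω')
    (f : Points K B Ω) (x : E ⊗[K] B) :
    evalAt (j.comp ι) (Points.map K B j f) x = j (evalAt ι f x) := by
  suffices h : evalAt (j.comp ι) (Points.map K B j f) = j.comp (evalAt ι f) from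
    DFunLike.congr_fun h x
  ext
  · simp [evalAt_tmul]
  · simp only [AlgHom.comp_apply, Algebra.TensorProduct.includeRight_apply, evalAt_tmul, map_one,
      one_mul, AlgHom.coe_restrictScalars']
    rfl
/-- Group-like elements are multiplicative in the point. -/
theorem evalAt_mul_of_isGroupLike [Coalgebra.IsCocomm K B] (ι : E →ₐ[K] Ω) (f g : Points K B Ω)
    {x : E ⊗[K] B} (hx : IsGroupLikeElem E x) :
    evalAt ι (f * g) x = evalAt ι f x * evalAt ι g x := by
  let : Algebra E Ω := ι.toAlgebra
  have : IsScalarTower K E Ω := .of_algebraMap_eq fun x ↦ (ι.commutes x).symm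
  let F (f : Points K B Ω) : E ⊗[K] B →ₐ[E] Ω :=
    { evalAt ι f with
      commutes' := fun s ↦ by
        change evalAt ι f (s ⊗ₜ 1) = ι s
        simp [evalAt_tmul] }
  have key : F (f * g) = (Algebra.TensorProduct.lift (F f) (F g) fun _ _ ↦ .all _ _).comp
      (Bialgebra.comulAlgHom E (E ⊗[K] B)) := by
    refine Algebra.TensorProduct.ext (by ext) (AlgHom.ext fun b ↦ ?_)
    change evalAt ι (f * g) (1 ⊗ₜ b) = Algebra.TensorProduct.lift (F f) (F g) (fun _ _ ↦ .all _ _)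
      (Coalgebra.comul (1 ⊗ₜ b))
    have hF (f : Points K B Ω) (b : B) : F f (1 ⊗ₜ b) = f.ofConv b := by
      change evalAt ι f (1 ⊗ₜ b) = _
      simp [evalAt_tmul]
    have h1 : (f * g).ofConv b = Algebra.TensorProduct.lift f.ofConv g.ofConv
        (fun _ _ ↦ .all _ _) (Coalgebra.comul b) := AlgHom.convMul_apply f g b
    rw [evalAt_tmul, map_one, one_mul, h1, TensorProduct.comul_tmul,
      ← (Coalgebra.Repr.arbitrary K b).eq]
    simp [TensorProduct.tmul_sum, hF]
  have := DFunLike.congr_fun key x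
  change evalAt ι (f * g) x = Algebra.TensorProduct.lift (F f) (F g) (fun _ _ ↦ .all _ _)
    (Coalgebra.comul x) at this
  rw [this, hx.comul_eq_tmul_self, Algebra.TensorProduct.lift_tmul]
  rfl
theorem evalAt_comap {C : Type*} [CommRing C] [HopfAlgebra K C] [Coalgebra.IsCocomm K B]
    [Coalgebra.IsCocomm K C] (q : C →ₐc[K] B) (ι : E →ₐ[K] Ω) (f : Points K B Ω) (x : E ⊗[K] C) :
    evalAt ι (Points.comap K Ω q f) x =
      evalAt ι f (Bialgebra.TensorProduct.map (.id E E) q x) := by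
  suffices h : evalAt ι (Points.comap K Ω q f) = (evalAt ι f).comp
      (Algebra.TensorProduct.map (.id K E) (q : C →ₐ[K] B)) from DFunLike.congr_fun h x
  ext
  · simp [evalAt_tmul]
  · simp only [AlgHom.comp_apply, Algebra.TensorProduct.includeRight_apply, evalAt_tmul, map_one,
      one_mul, AlgHom.coe_restrictScalars', Algebra.TensorProduct.map_tmul]
    rfl
/-- Evaluation is equivariant, with the Galois group acting on characters through `galRes`. -/
theorem evalAt_galois [Normal K E] {L : Type*} [Field L] [Algebra K L] [Algebra L Ω]
    [IsScalarTower K L Ω] [Coalgebra.IsCocomm K B] (ι : E →ₐ[K] Ω) (τ : Gal(Ω/L))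
    (f : Points K B Ω) (x : E ⊗[K] B) :
    evalAt ι (τ • f) (Algebra.TensorProduct.map (galRes ι τ : E →ₐ[K] E) (AlgHom.id K B) x) =
      τ (evalAt ι f x) := by
  suffices h : (evalAt ι (τ • f)).comp
      (Algebra.TensorProduct.map (galRes ι τ : E →ₐ[K] E) (AlgHom.id K B)) =
      ((τ : Ω →ₐ[L] Ω).restrictScalars K).comp (evalAt ι f) from DFunLike.congr_fun h x
  ext s
  · simp [evalAt_tmul, galRes_apply]
  · simp only [AlgHom.comp_apply, Algebra.TensorProduct.includeRight_apply, evalAt_tmul, map_one,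
      one_mul, AlgHom.coe_restrictScalars', Algebra.TensorProduct.map_tmul]
    rfl

end Evaluation

/-! ### Character groups of diagonalizable groups -/

section CharGroup
variable (K : Type*) [Field K] (B : Type*) [CommRing B] [HopfAlgebra K B]
  (E : Type*) [Field E] [Algebra K E]
/-- The group of characters of `Spec B` over `E`: the group-like elements of `E ⊗ B`. -/
abbrev CharGroup := GroupLike E (E ⊗[K] B)
/-- Over `E`, the group `Spec B` becomes diagonalizable: the group-like elements of `E ⊗ B` form
a basis. -/
def IsDiagonalizableOver : Prop :=
  Function.Bijective (MonoidAlgebra.liftGroupLikeBialgHom (R := E) (A := E ⊗[K] B))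
variable {K B E}
theorem isDiagonalizableOver_of_bialgEquiv {Y : Type*} [CommGroup Y]
    (e : (E ⊗[K] B) ≃ₐc[E] MonoidAlgebra E Y) : IsDiagonalizableOver K B E := by
  constructor
  · rw [injective_iff_map_eq_zero]
    intro x hx
    have h := linearIndependent_iff.1 (linearIndep_groupLikeVal (R := E) (A := E ⊗[K] B)) x.coeff
    refine MonoidAlgebra.ext (h ?_)
    rw [Finsupp.linearCombination_apply, ← hx]
    simp [MonoidAlgebra.lift_apply]
  · intro x
    obtain ⟨z, rfl⟩ : ∃ z, (e.symm : MonoidAlgebra E Y →ₐc[E] E ⊗[K] B) z = x :=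
      e.symm.surjective x
    induction z using MonoidAlgebra.induction_linear with
    | zero => exact ⟨0, by simp⟩
    | add z w hz hw =>
      obtain ⟨z', hz⟩ := hz
      obtain ⟨w', hw⟩ := hw
      exact ⟨z' + w', by rw [map_add, map_add, hz, hw]⟩
    | single y a =>
      refine ⟨MonoidAlgebra.single
        ⟨e.symm (MonoidAlgebra.single y 1), (MonoidAlgebra.isGroupLikeElem_of y).map e.symm⟩ a, ?_⟩
      rw [← mul_one a, ← smul_eq_mul, ← MonoidAlgebra.smul_single, ← MonoidAlgebra.smul_single,
        map_smul, map_smul]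
      simp
theorem finite_charGroup_of_bialgEquiv {Y : Type*} [CommGroup Y] [Module.Finite ℤ (Additive Y)]
    (e : (E ⊗[K] B) ≃ₐc[E] MonoidAlgebra E Y) : Module.Finite ℤ (Additive (CharGroup K B E)) := by
  let g : Y →* CharGroup K B E :=
    { toFun y := ⟨e.symm (MonoidAlgebra.of E Y y), (MonoidAlgebra.isGroupLikeElem_of y).map e.symm⟩
      map_one' := GroupLike.val_injective <| by
        change e.symm (MonoidAlgebra.of E Y 1) = 1
        rw [map_one, map_one]
      map_mul' x y := GroupLike.val_injective <| by
        change e.symm (MonoidAlgebra.of E Y (x * y)) =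
          e.symm (MonoidAlgebra.of E Y x) * e.symm (MonoidAlgebra.of E Y y)
        rw [map_mul, map_mul] }
  refine Module.Finite.of_surjective (MonoidHom.toAdditive g).toIntLinearMap fun x ↦ ?_
  obtain ⟨y, hy⟩ := MonoidAlgebra.isGroupLikeElem_iff_mem_range_of.1 (x.toMul.2.map e)
  refine ⟨Additive.ofMul y, congrArg Additive.ofMul (GroupLike.val_injective ?_)⟩
  change e.symm (MonoidAlgebra.of E Y y) = _
  rw [hy]
  exact e.symm_apply_apply _
variable {Ω : Type*} [Field Ω] [Algebra K Ω] [Coalgebra.IsCocomm K B]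
variable (B) in
/-- The pairing between characters of `Spec B` over `E` and points of `Spec B` in `Ω`. -/
def charEval (ι : E →ₐ[K] Ω) : Points K B Ω →* (CharGroup K B E →* Ω) where
  toFun f := (evalAt ι f : E ⊗[K] B →* Ω).comp (GroupLike.valMonoidHom E (E ⊗[K] B))
  map_one' := MonoidHom.ext fun x ↦ by
    have h := evalAt_mul_of_isGroupLike ι (1 : Points K B Ω) 1 x.2
    rw [mul_one] at h
    have hx : IsUnit (evalAt ι (1 : Points K B Ω) x.val) := x.2.isUnit.map _
    exact (mul_eq_left₀ hx.ne_zero).1 h.symm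
  map_mul' f g := MonoidHom.ext fun x ↦ evalAt_mul_of_isGroupLike ι f g x.2
theorem charEval_apply (ι : E →ₐ[K] Ω) (f : Points K B Ω) (x : CharGroup K B E) :
    charEval B ι f x = evalAt ι f x.val := rfl
/-- A point of a diagonalizable group is the same as a homomorphism on the character group. -/
theorem charEval_bijective (hB : IsDiagonalizableOver K B E) (ι : E →ₐ[K] Ω) :
    Function.Bijective (charEval B ι) := by
  constructor
  · intro f g h
    refine evalAt_injective ι (AlgHom.ext fun x ↦ ?_)
    obtain ⟨z, rfl⟩ := hB.2 x
    induction z using MonoidAlgebra.induction_linear with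
    | zero => simp
    | add z w hz hw => rw [map_add, map_add, map_add, hz, hw]
    | single y a =>
      rw [← mul_one a, ← smul_eq_mul, ← MonoidAlgebra.smul_single, map_smul, evalAt_smul,
        evalAt_smul]
      congr 1
      have h := DFunLike.congr_fun h y
      rw [charEval_apply, charEval_apply] at h
      simpa using h
  · intro χ
    let : Algebra E Ω := ι.toAlgebra
    have : IsScalarTower K E Ω := .of_algebraMap_eq fun x ↦ (ι.commutes x).symm
    let e : MonoidAlgebra E (CharGroup K B E) ≃ₐ[E] E ⊗[K] B :=
      AlgEquiv.ofBijective (MonoidAlgebra.liftGroupLikeBialgHom (R := E) (A := E ⊗[K] B) :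
        MonoidAlgebra E (CharGroup K B E) →ₐ[E] E ⊗[K] B) hB
    let ψ : E ⊗[K] B →ₐ[E] Ω := (MonoidAlgebra.lift E Ω (CharGroup K B E) χ).comp e.symm
    let f : Points K B Ω :=
      toConv ((ψ.restrictScalars K).comp Algebra.TensorProduct.includeRight)
    refine ⟨f, MonoidHom.ext fun x ↦ ?_⟩
    have h : evalAt ι f = ψ.restrictScalars K := by
      ext s
      · simp only [AlgHom.comp_apply, AlgHom.coe_restrictScalars',
          Algebra.TensorProduct.includeLeft_apply, evalAt_tmul, map_one, mul_one]
        exact (ψ.commutes s).symm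
      · simp only [AlgHom.comp_apply, AlgHom.coe_restrictScalars',
          Algebra.TensorProduct.includeRight_apply, evalAt_tmul, map_one, one_mul]
        rfl
    rw [charEval_apply, h]
    have hx : e (MonoidAlgebra.single x 1) = x.val :=
      (MonoidAlgebra.lift_single ..).trans (one_smul _ _)
    change MonoidAlgebra.lift E Ω (CharGroup K B E) χ (e.symm x.val) = _
    rw [← hx, AlgEquiv.symm_apply_apply]
    simp
/-- The homomorphism of character groups induced by a homomorphism of groups. -/
def charMap {C : Type*} [CommRing C] [HopfAlgebra K C] (E : Type*) [Field E] [Algebra K E]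
    (q : C →ₐc[K] B) : CharGroup K C E →* CharGroup K B E where
  toFun x := ⟨Bialgebra.TensorProduct.map (.id E E) q x.val, x.2.map _⟩
  map_one' := GroupLike.val_injective (map_one _)
  map_mul' _ _ := GroupLike.val_injective (map_mul _ _ _)
theorem charEval_comap {C : Type*} [CommRing C] [HopfAlgebra K C] [Coalgebra.IsCocomm K C]
    (q : C →ₐc[K] B) (ι : E →ₐ[K] Ω) (f : Points K B Ω) :
    charEval C ι (Points.comap K Ω q f) = (charEval B ι f).comp (charMap E q) :=
  MonoidHom.ext fun x ↦ evalAt_comap q ι f x.val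

end CharGroup

/-! ### Almost split extensions of finitely generated abelian groups -/

/-- An injection of abelian groups with finitely generated target is split up to a multiple `d`. If
its cokernel has no `p`-torsion for the characteristic `p` of `k`, then `d` is invertible in `k`. -/
theorem exists_almost_retraction {X Y : Type*} [AddCommGroup X] [AddCommGroup Y] (φ : X →+ Y)
    (hφ : Function.Injective φ) [Module.Finite ℤ Y] (k : Type*) [Field k]
    (htor : ∀ p : ℕ, p.Prime → (p : k) = 0 → ∀ y, p • y ∈ φ.range → y ∈ φ.range) :
    ∃ (s : Y →+ X) (d : ℕ), (d : k) ≠ 0 ∧ ∀ x, s (φ x) = d • x := by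
  let R : Submodule ℤ Y := LinearMap.range φ.toIntLinearMap
  let t := Submodule.torsion ℤ (Y ⧸ R)
  have hfin : Finite t := Module.finite_of_fg_torsion t (Submodule.torsion_isTorsion)
  have hfree : Module.Free ℤ ((Y ⧸ R) ⧸ t) := inferInstance
  let π : Y →ₗ[ℤ] (Y ⧸ R) ⧸ t := t.mkQ ∘ₗ R.mkQ
  have hπ : Function.Surjective π := (t.mkQ_surjective).comp R.mkQ_surjective
  -- A section of the projection to the free part of the cokernel splits `φ` up to the order of the
  -- torsion subgroup `t`.
  obtain ⟨σ, hσ⟩ := Module.projective_lifting_property π LinearMap.id hπ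
  have hmem (y : Y) : Nat.card t • (y - σ (π y)) ∈ R := by
    have h1 : R.mkQ (y - σ (π y)) ∈ t := by
      rw [← Submodule.Quotient.mk_eq_zero]
      change π (y - σ (π y)) = 0
      rw [map_sub, sub_eq_zero]
      exact (LinearMap.congr_fun hσ (π y)).symm
    rw [← Submodule.Quotient.mk_eq_zero]
    change R.mkQ _ = 0
    rw [map_nsmul]
    have := card_nsmul_eq_zero' (G := t) (x := ⟨_, h1⟩)
    exact congrArg Subtype.val this
  let e : X ≃ₗ[ℤ] R := LinearEquiv.ofInjective φ.toIntLinearMap hφ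
  let s : Y →ₗ[ℤ] X := e.symm.toLinearMap ∘ₗ
    (Nat.card t • (LinearMap.id - σ ∘ₗ π)).codRestrict R fun y ↦ by simpa using hmem y
  refine ⟨s.toAddMonoidHom, Nat.card t, fun hd ↦ ?_, fun x ↦ ?_⟩
  -- If the characteristic divides the order of `t`, then Cauchy's theorem yields a torsion element.
  · have hdvd := (ringChar.spec k _).1 hd
    have hprime : (ringChar k).Prime := (CharP.char_is_prime_or_zero k (ringChar k)).resolve_right
      fun h ↦ Nat.card_pos.ne' (Nat.eq_zero_of_zero_dvd (h ▸ hdvd))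
    have : Fact (ringChar k).Prime := ⟨hprime⟩
    obtain ⟨z, hz⟩ := exists_prime_addOrderOf_dvd_card' (G := t) (ringChar k) hdvd
    obtain ⟨y, hy⟩ := R.mkQ_surjective z.1
    have h0 : ringChar k • y ∈ φ.range := by
      change _ ∈ R
      rw [← Submodule.Quotient.mk_eq_zero]
      change R.mkQ _ = 0
      rw [map_nsmul, hy, ← hz]
      exact congrArg Subtype.val (addOrderOf_nsmul_eq_zero z)
    have h1 : y ∈ R := htor _ hprime (ringChar.Nat.cast_ringChar) y h0
    have h2 : z = 0 := by
      apply Subtype.ext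
      rw [← hy]
      exact (Submodule.Quotient.mk_eq_zero R).2 h1
    rw [h2, addOrderOf_zero] at hz
    exact hprime.one_lt.ne hz
  · change e.symm _ = _
    rw [LinearEquiv.symm_apply_eq]
    apply Subtype.ext
    have : π (φ x) = 0 := by
      change t.mkQ (R.mkQ _) = 0
      rw [show R.mkQ (φ x) = 0 from (Submodule.Quotient.mk_eq_zero R).2 ⟨x, rfl⟩, map_zero]
    simp [this, e]
    rfl

/-! ### Exact sequences of diagonalizable groups -/

section Exact
/-- Every subgroup of a commutative group is a kernel. The abstract target keeps the concrete
quotient out of the group algebras below. -/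
theorem exists_ker_eq {G : Type u} [CommGroup G] (N : Subgroup G) :
    ∃ (Q : Type u) (_ : CommGroup Q) (π : G →* Q), π.ker = N :=
  ⟨G ⧸ N, inferInstance, QuotientGroup.mk' N, QuotientGroup.ker_mk' N⟩
variable {K : Type*} [Field K] {A B C : Type*} [CommRing A] [CommRing B] [CommRing C]
  [HopfAlgebra K A] [HopfAlgebra K B] [HopfAlgebra K C]
  [Coalgebra.IsCocomm K A] [Coalgebra.IsCocomm K B] [Coalgebra.IsCocomm K C]
  {i : B →ₐc[K] A} {q : C →ₐc[K] B}
theorem IsShortExact.comp_apply (h : IsShortExact i q) (c : C) :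
    i (q c) = algebraMap K A (Coalgebra.counit c) := by
  have h1 : q (c - algebraMap K C (Coalgebra.counit c)) ∈ RingHom.ker (i : B →ₐ[K] A) := by
    rw [h.ker_eq]
    refine Ideal.mem_map_of_mem (q : C →ₐ[K] B) ?_
    rw [RingHom.mem_ker]
    simp
  rw [RingHom.mem_ker] at h1
  have h2 : i (q (c - algebraMap K C (Coalgebra.counit c))) = 0 := h1
  rwa [map_sub, map_sub, AlgHomClass.commutes, AlgHomClass.commutes, sub_eq_zero] at h2
variable (E : Type*) [Field E] [Algebra K E]
theorem IsShortExact.charMap_injective (h : IsShortExact i q) :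
    Function.Injective (charMap E q) := by
  intro x y hxy
  have hq : Function.Injective (q : C →ₐ[K] B).toLinearMap := h.faithfullyFlat.injective
  have := Module.Flat.lTensor_preserves_injective_linearMap (M := E) _ hq
  exact GroupLike.val_injective (this (congrArg GroupLike.val hxy))
theorem IsShortExact.charMap_charMap (h : IsShortExact i q) (x : CharGroup K C E) :
    charMap E i (charMap E q x) = 1 := by
  have key : ((Bialgebra.TensorProduct.map (.id E E) i : E ⊗[K] B →ₐ[E] E ⊗[K] A).comp
      (Bialgebra.TensorProduct.map (.id E E) q : E ⊗[K] C →ₐ[E] E ⊗[K] B)) =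
      (Algebra.ofId E (E ⊗[K] A)).comp (Bialgebra.counitAlgHom E (E ⊗[K] C)) := by
    refine Algebra.TensorProduct.ext (by ext) (AlgHom.ext fun c ↦ ?_)
    simp [h.comp_apply, Algebra.ofId_apply, Algebra.algebraMap_eq_smul_one,
      Algebra.TensorProduct.one_def]
  apply GroupLike.val_injective
  refine (DFunLike.congr_fun key x.val).trans ?_
  simp [x.2.counit_eq_one, Algebra.TensorProduct.one_def]
/-- A character of `Spec B` that is trivial on `Spec A` comes from `Spec C`. By the description of
the kernel of `i`, the projection of the group algebra of characters of `Spec B` to that of the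
quotient by the characters of `Spec C` factors through `E ⊗ A`. -/
theorem IsShortExact.mem_range_charMap (h : IsShortExact i q) (hB : IsDiagonalizableOver K B E)
    (hC : IsDiagonalizableOver K C E) {y : CharGroup K B E} (hy : charMap E i y = 1) :
    y ∈ (charMap E q).range := by
  obtain ⟨Q, _, π, hπ⟩ := exists_ker_eq (charMap E q).range
  let e : MonoidAlgebra E (CharGroup K B E) ≃ₐ[E] E ⊗[K] B :=
    AlgEquiv.ofBijective (MonoidAlgebra.liftGroupLikeBialgHom (R := E) (A := E ⊗[K] B) :
      MonoidAlgebra E (CharGroup K B E) →ₐ[E] E ⊗[K] B) hB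
  have he (x : CharGroup K B E) : e.symm x.val = MonoidAlgebra.single x 1 := by
    rw [AlgEquiv.symm_apply_eq]
    exact ((MonoidAlgebra.lift_single ..).trans (one_smul _ _)).symm
  let φ : E ⊗[K] B →ₐ[E] MonoidAlgebra E Q :=
    (MonoidAlgebra.mapDomainAlgHom E E π).comp e.symm
  have hφ (x : CharGroup K B E) : φ x.val = MonoidAlgebra.single (π x) 1 := by
    change MonoidAlgebra.mapDomainAlgHom E E π (e.symm x.val) = _
    rw [he]
    simp
  have hφq (t : E ⊗[K] C) : φ (Bialgebra.TensorProduct.map (.id E E) q t) =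
      MonoidAlgebra.single 1 (Coalgebra.counit (R := E) t) := by
    obtain ⟨z, rfl⟩ := hC.2 t
    induction z using MonoidAlgebra.induction_linear with
    | zero => simp
    | add z w hz hw => simp only [map_add, hz, hw, MonoidAlgebra.single_add]
    | single x a =>
      rw [← mul_one a, ← smul_eq_mul, ← MonoidAlgebra.smul_single, map_smul, map_smul, map_smul,
        map_smul]
      have h1 : MonoidAlgebra.liftGroupLikeBialgHom (R := E) (MonoidAlgebra.single x 1) = x.val :=
        (MonoidAlgebra.lift_single ..).trans (one_smul _ _)
      rw [h1, x.2.counit_eq_one]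
      have h2 := hφ (charMap E q x)
      have h3 : π (charMap E q x) = 1 := MonoidHom.mem_ker.1 (hπ ▸ ⟨x, rfl⟩)
      rw [h3] at h2
      change a • φ (charMap E q x).val = _
      rw [h2, smul_eq_mul, mul_one]
      simp
  have hker (t : E ⊗[K] B) (ht : Bialgebra.TensorProduct.map (.id E E) i t = 0) : φ t = 0 := by
    have hmem : t ∈ RingHom.ker (Algebra.TensorProduct.map (.id K E) (i : B →ₐ[K] A)) := ht
    rw [Algebra.TensorProduct.lTensor_ker _ h.surjective, h.ker_eq] at hmem
    suffices hle : _ ≤ RingHom.ker φ from hle hmem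
    rw [Ideal.map_le_iff_le_comap, Ideal.map_le_iff_le_comap]
    intro c hc
    change φ (Bialgebra.TensorProduct.map (.id E E) q (1 ⊗ₜ c)) = 0
    rw [hφq]
    have hc : Coalgebra.counit (R := K) c = 0 := hc
    simp [hc]
  have h1 := hker (y.val - 1) (by
    rw [map_sub, map_one, sub_eq_zero]
    exact congrArg GroupLike.val hy)
  rw [map_sub, map_one, sub_eq_zero, hφ, MonoidAlgebra.one_def] at h1
  have h2 := Finsupp.single_left_injective (one_ne_zero) (congrArg MonoidAlgebra.coeff h1)
  exact hπ ▸ MonoidHom.mem_ker.2 h2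
/-- Smoothness of the kernel rules out `p`-torsion in the cokernel of the map of characters. -/
theorem IsShortExact.mem_range_charMap_of_pow (h : IsShortExact i q)
    (hB : IsDiagonalizableOver K B E) (hC : IsDiagonalizableOver K C E) [Algebra.Smooth K A]
    {p : ℕ} (hp : p.Prime) (hpK : (p : K) = 0) {y : CharGroup K B E}
    (hy : y ^ p ∈ (charMap E q).range) : y ∈ (charMap E q).range := by
  refine h.mem_range_charMap E hB hC ?_
  obtain ⟨x, hx⟩ := hy
  have h1 : (charMap E i y) ^ p = 1 := by rw [← map_pow, ← hx, h.charMap_charMap E]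
  have : IsReduced (E ⊗[K] A) := isReduced_of_smooth E (E ⊗[K] A)
  apply GroupLike.val_injective
  rcases subsingleton_or_nontrivial (E ⊗[K] A) with hs | hs
  · exact Subsingleton.elim _ _
  have : Fact p.Prime := ⟨hp⟩
  have : CharP (E ⊗[K] A) p := by
    rw [CharP.charP_iff_prime_eq_zero hp]
    simpa using congrArg (algebraMap K (E ⊗[K] A)) hpK
  have h2 : ((charMap E i y).val - 1) ^ p = 0 := by
    rw [sub_pow_char, one_pow, sub_eq_zero]
    exact congrArg GroupLike.val h1
  exact sub_eq_zero.1 (pow_eq_zero_iff hp.ne_zero |>.1 h2)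
/-- The inclusion of character groups is split up to a power prime to the characteristic. -/
theorem IsShortExact.exists_almost_retraction (h : IsShortExact i q)
    (hB : IsDiagonalizableOver K B E) (hC : IsDiagonalizableOver K C E) [Algebra.Smooth K A]
    [Module.Finite ℤ (Additive (CharGroup K B E))] :
    ∃ (s : CharGroup K B E →* CharGroup K C E) (d : ℕ), (d : K) ≠ 0 ∧
      ∀ x, s (charMap E q x) = x ^ d := by
  obtain ⟨s, d, hd, hs⟩ := FlasqueGW.exists_almost_retraction (MonoidHom.toAdditive (charMap E q))
    (h.charMap_injective E) K fun p hp hpK y hy ↦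
      h.mem_range_charMap_of_pow E hB hC hp hpK (y := y.toMul) hy
  exact ⟨MonoidHom.toAdditive.symm s, d, hd, hs⟩

end Exact

section ExactPoints
variable {K : Type*} [Field K] {A B C : Type*} [CommRing A] [CommRing B] [CommRing C]
  [HopfAlgebra K A] [HopfAlgebra K B] [HopfAlgebra K C]
  [Coalgebra.IsCocomm K A] [Coalgebra.IsCocomm K B] [Coalgebra.IsCocomm K C]
  {i : B →ₐc[K] A} {q : C →ₐc[K] B}
theorem IsShortExact.comap_injective (h : IsShortExact i q) (R : Type*) [CommRing R]
    [Algebra K R] : Function.Injective (Points.comap K R i) := by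
  intro f g hfg
  refine WithConv.ext (AlgHom.ext fun a ↦ ?_)
  obtain ⟨b, rfl⟩ := h.surjective a
  exact DFunLike.congr_fun (congrArg WithConv.ofConv hfg) b
theorem IsShortExact.comap_comap (h : IsShortExact i q) (R : Type*) [CommRing R]
    [Algebra K R] (f : Points K A R) : Points.comap K R q (Points.comap K R i f) = 1 := by
  refine WithConv.ext (AlgHom.ext fun c ↦ ?_)
  change f.ofConv (i (q c)) = algebraMap K R (Coalgebra.counit c)
  rw [h.comp_apply, AlgHom.commutes]
theorem IsShortExact.exists_comap_eq (h : IsShortExact i q) {R : Type*} [CommRing R]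
    [Algebra K R] {f : Points K B R} (hf : Points.comap K R q f = 1) :
    ∃ g, Points.comap K R i g = f := by
  have hker : ∀ b, (i : B →ₐ[K] A) b = 0 → f.ofConv b = 0 := by
    intro b hb
    have hb : b ∈ RingHom.ker (i : B →ₐ[K] A) := hb
    rw [h.ker_eq] at hb
    suffices hle : _ ≤ RingHom.ker f.ofConv from hle hb
    rw [Ideal.map_le_iff_le_comap]
    intro c hc
    have hc : Coalgebra.counit (R := K) c = 0 := hc
    have h1 := DFunLike.congr_fun (congrArg WithConv.ofConv hf) c
    change f.ofConv (q c) = algebraMap K R (Coalgebra.counit c) at h1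
    rw [hc, map_zero] at h1
    exact h1
  refine ⟨toConv (AlgHom.liftOfSurjective (i : B →ₐ[K] A) h.surjective f.ofConv hker), ?_⟩
  refine WithConv.ext (AlgHom.ext fun b ↦ ?_)
  exact AlgHom.liftOfSurjective_apply (i : B →ₐ[K] A) h.surjective f.ofConv hker b
/-- Composition with an almost retraction of character groups lifts `d`-th powers of points. -/
theorem exists_comap_eq_pow {E : Type*} [Field E] [Algebra K E]
    (hB : IsDiagonalizableOver K B E) (hC : IsDiagonalizableOver K C E)
    {s : CharGroup K B E →* CharGroup K C E} {d : ℕ}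
    (hs : ∀ x, s (charMap E q x) = x ^ d) {Ω : Type*} [Field Ω] [Algebra K Ω]
    (ι : E →ₐ[K] Ω) (p : Points K C Ω) :
    ∃ f : Points K B Ω, Points.comap K Ω q f = p ^ d ∧
      charEval B ι f = (charEval C ι p).comp s := by
  obtain ⟨f, hf⟩ := (charEval_bijective hB ι).2 ((charEval C ι p).comp s)
  refine ⟨f, (charEval_bijective hC ι).1 (MonoidHom.ext fun x ↦ ?_), hf⟩
  rw [charEval_comap, hf, map_pow]
  simp [hs]
/-- Homomorphisms from a group to a field take values in units, hence are determined on a basis. -/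
theorem charGroup_hom_ext_of_basis {E : Type*} [Field E] [Algebra K E] {I : Type*}
    (b : Module.Basis I ℤ (Additive (CharGroup K C E))) {Ω : Type*} [Field Ω]
    {χ χ' : CharGroup K C E →* Ω} (h : ∀ j, χ (b j).toMul = χ' (b j).toMul) : χ = χ' := by
  have key : χ.toHomUnits = χ'.toHomUnits :=
    MonoidHom.toAdditive.injective <| AddMonoidHom.toIntLinearMap_injective <| b.ext fun j ↦
      congrArg Additive.ofMul (Units.ext (h j))
  exact MonoidHom.ext fun x ↦ congrArg Units.val (DFunLike.congr_fun key x)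
theorem charEval_ext_of_basis {E : Type*} [Field E] [Algebra K E]
    (hC : IsDiagonalizableOver K C E) {I : Type*}
    (b : Module.Basis I ℤ (Additive (CharGroup K C E))) {Ω : Type*} [Field Ω] [Algebra K Ω]
    (ι : E →ₐ[K] Ω) {p p' : Points K C Ω}
    (h : ∀ j, charEval C ι p (b j).toMul = charEval C ι p' (b j).toMul) : p = p' :=
  (charEval_bijective hC ι).1 (charGroup_hom_ext_of_basis b h)
theorem exists_point_of_basis {E : Type*} [Field E] [Algebra K E]
    (hC : IsDiagonalizableOver K C E) {I : Type*}
    (b : Module.Basis I ℤ (Additive (CharGroup K C E))) {Ω : Type*} [Field Ω] [Algebra K Ω]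
    (ι : E →ₐ[K] Ω) (t : I → Ωˣ) :
    ∃ p : Points K C Ω, ∀ j, charEval C ι p (b j).toMul = t j := by
  let l : Additive (CharGroup K C E) →ₗ[ℤ] Additive Ωˣ := b.constr ℤ fun j ↦ Additive.ofMul (t j)
  let χ : CharGroup K C E →* Ωˣ := MonoidHom.toAdditive.symm l.toAddMonoidHom
  obtain ⟨p, hp⟩ := (charEval_bijective hC ι).2 ((Units.coeHom Ω).comp χ)
  refine ⟨p, fun j ↦ ?_⟩
  rw [hp]
  have : l (b j) = Additive.ofMul (t j) := b.constr_basis ..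
  exact congrArg (fun x : Additive Ωˣ ↦ (x.toMul : Ω)) this
theorem charEval_ne_zero {E : Type*} [Field E] [Algebra K E] {Ω : Type*} [Field Ω] [Algebra K Ω]
    (ι : E →ₐ[K] Ω) (p : Points K C Ω) (x : CharGroup K C E) : charEval C ι p x ≠ 0 :=
  (Group.isUnit x).map (charEval C ι p) |>.ne_zero
/-- A homomorphism of tori is surjective on points over a separably closed field if its map on
characters has a retraction up to a power prime to the characteristic: coordinates have `d`-th
roots, and `d`-th powers of points lift. -/
theorem comap_surjective_of_isSepClosed {E : Type*} [Field E] [Algebra K E]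
    (hB : IsDiagonalizableOver K B E) (hC : IsDiagonalizableOver K C E) {I : Type*}
    (b : Module.Basis I ℤ (Additive (CharGroup K C E)))
    {s : CharGroup K B E →* CharGroup K C E} {d : ℕ} (hd : (d : K) ≠ 0)
    (hs : ∀ x, s (charMap E q x) = x ^ d) {Ω : Type*} [Field Ω] [Algebra K Ω] [IsSepClosed Ω]
    (ι : E →ₐ[K] Ω) : Function.Surjective (Points.comap K Ω q) := by
  intro p
  have : NeZero (d : Ω) := ⟨by simpa using (map_ne_zero (algebraMap K Ω)).2 hd⟩
  have hd0 : d ≠ 0 := by rintro rfl; simp at hd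
  choose r hr using fun j ↦ IsSepClosed.exists_pow_nat_eq (charEval C ι p (b j).toMul) d
  have hr0 (j) : r j ≠ 0 := fun h0 ↦ charEval_ne_zero ι p (b j).toMul <| by
    rw [← hr j, h0, zero_pow hd0]
  obtain ⟨p', hp'⟩ := exists_point_of_basis hC b ι fun j ↦ Units.mk0 (r j) (hr0 j)
  obtain ⟨f, hf, -⟩ := exists_comap_eq_pow hB hC hs ι p'
  refine ⟨f, hf.trans (charEval_ext_of_basis hC b ι fun j ↦ ?_)⟩
  rw [map_pow, MonoidHom.pow_apply, hp', Units.val_mk0, hr]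

end ExactPoints

/-! ### Sums and products over embeddings -/

section Embeddings
open Topology
variable {L Ω : Type*} [Field L] [Field Ω] [Algebra L Ω]
theorem eventually_galois_apply_eq [Algebra.IsAlgebraic L Ω] (x : Ω) :
    ∀ᶠ τ in 𝓝 (1 : Gal(Ω/L)), τ x = x := by
  rw [Filter.Eventually, krullTopology_mem_nhds_one_iff]
  refine ⟨IntermediateField.adjoin L {x}, IntermediateField.adjoin.finiteDimensional
    (Algebra.IsIntegral.isIntegral x), fun σ hσ ↦ ?_⟩
  exact (IntermediateField.mem_fixingSubgroup_iff _ _).1 hσ x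
    (IntermediateField.mem_adjoin_simple_self L x)
/-- A property that holds near `1` in the Krull topology holds on the subgroup fixing some finite
subextension. -/
theorem exists_finiteDimensional_of_eventually {P : Gal(Ω/L) → Prop}
    (h : ∀ᶠ τ in 𝓝 (1 : Gal(Ω/L)), P τ) :
    ∃ F : IntermediateField L Ω, FiniteDimensional L F ∧ ∀ τ, (∀ x ∈ F, τ x = x) → P τ := by
  rw [Filter.Eventually, krullTopology_mem_nhds_one_iff] at h
  obtain ⟨F, hF, hFP⟩ := h
  exact ⟨F, hF, fun τ hτ ↦ hFP ((IntermediateField.mem_fixingSubgroup_iff _ _).2 hτ)⟩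
variable [Normal L Ω] (F : IntermediateField L Ω)
/-- An automorphism of `Ω` extending an embedding `F → Ω` over `L`. -/
def embLift (φ : F →ₐ[L] Ω) : Gal(Ω/L) :=
  AlgEquiv.ofBijective (φ.liftNormal Ω) (AlgHom.normal_bijective L Ω Ω _)
theorem embLift_apply (φ : F →ₐ[L] Ω) (x : F) : embLift F φ x = φ x :=
  φ.liftNormal_commutes Ω x
/-- A product over the embeddings `F → Ω`, written as a product of values of a function on the
Galois group that only depends on the restriction to `F`, is invariant under translation. -/
theorem prod_embLift_mul [FiniteDimensional L F] {M : Type*} [CommMonoid M] {h : Gal(Ω/L) → M}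
    (hh : ∀ σ τ, (∀ x ∈ F, τ x = x) → h (σ * τ) = h σ) (τ : Gal(Ω/L)) :
    ∏ φ : F →ₐ[L] Ω, h (τ * embLift F φ) = ∏ φ : F →ₐ[L] Ω, h (embLift F φ) := by
  refine Fintype.prod_equiv (AlgEquiv.arrowCongr .refl τ) _ _ fun φ ↦ ?_
  have := hh (embLift F (AlgEquiv.arrowCongr .refl τ φ))
    ((embLift F (AlgEquiv.arrowCongr .refl τ φ))⁻¹ * (τ * embLift F φ)) fun x hx ↦ ?_
  · rwa [mul_inv_cancel_left] at this
  · rw [AlgEquiv.mul_apply, AlgEquiv.mul_apply, AlgEquiv.aut_inv, AlgEquiv.symm_apply_eq,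
      embLift_apply F φ ⟨x, hx⟩, embLift_apply F _ ⟨x, hx⟩]
    rfl
theorem sum_embLift_mul [FiniteDimensional L F] {M : Type*} [AddCommMonoid M] {h : Gal(Ω/L) → M}
    (hh : ∀ σ τ, (∀ x ∈ F, τ x = x) → h (σ * τ) = h σ) (τ : Gal(Ω/L)) :
    ∑ φ : F →ₐ[L] Ω, h (τ * embLift F φ) = ∑ φ : F →ₐ[L] Ω, h (embLift F φ) :=
  prod_embLift_mul (M := Multiplicative M) F hh τ

end Embeddings

/-! ### Hilbert's theorem 90 for permutation modules -/

section Hilbert90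
open Topology
variable {L Ω : Type*} [Field L] [Field Ω] [Algebra L Ω] [Normal L Ω]
/-- Hilbert's theorem 90 for the points of a quasi-trivial torus, in coordinates. -/
theorem exists_coboundary_of_permutation {I : Type*} [Finite I] [MulAction Gal(Ω/L) I]
    (hI : ∀ j : I, ∀ᶠ τ in 𝓝 (1 : Gal(Ω/L)), τ • j = j) (c : Gal(Ω/L) → I → Ω)
    (hc0 : ∀ σ j, c σ j ≠ 0) (hc : ∀ σ τ j, c (σ * τ) j = c σ j * σ (c τ (σ⁻¹ • j)))
    (hcont : ∀ᶠ τ in 𝓝 (1 : Gal(Ω/L)), c τ = 1) :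
    ∃ β : I → Ω, (∀ j, β j ≠ 0) ∧ ∀ σ j, c σ j = σ (β (σ⁻¹ • j)) / β j := by
  classical
  obtain ⟨F, hF, hFP⟩ := exists_finiteDimensional_of_eventually
    (hcont.and (Filter.eventually_all.2 hI))
  let rep (j : I) : I := (Quotient.mk (MulAction.orbitRel Gal(Ω/L) I) j).out
  have hrep (j : I) : ∃ τ : Gal(Ω/L), τ • rep j = j := by
    have := Quotient.exact (Quotient.out_eq (Quotient.mk (MulAction.orbitRel Gal(Ω/L) I) j))
    obtain ⟨τ, hτ⟩ := (MulAction.orbitRel Gal(Ω/L) I).symm this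
    exact ⟨τ, hτ⟩
  have hrep' (τ : Gal(Ω/L)) (j : I) : rep (τ • j) = rep j := by
    have : Quotient.mk (MulAction.orbitRel Gal(Ω/L) I) (τ • j) = Quotient.mk _ j :=
      Quotient.sound ⟨τ, rfl⟩
    simp only [rep, this]
  -- Independence of characters provides the coefficient at the representative of each orbit.
  have hα (r : I) : ∃ α : F, ∑ φ : F →ₐ[L] Ω,
      (if embLift F φ • r = r then c (embLift F φ) r else 0) * φ α ≠ 0 := by
    by_contra! h
    have hli : LinearIndependent Ω (fun φ : F →ₐ[L] Ω ↦ ((φ : F →* Ω) : F → Ω)) :=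
      (linearIndependent_monoidHom F Ω).comp (fun φ : F →ₐ[L] Ω ↦ (φ : F →* Ω))
        fun φ ψ hφ ↦ AlgHom.ext fun x ↦ DFunLike.congr_fun hφ x
    have h0 := Fintype.linearIndependent_iff.1 hli
      (fun φ ↦ if embLift F φ • r = r then c (embLift F φ) r else 0)
      (funext fun x ↦ by
        rw [Finset.sum_apply]
        exact h x) F.val
    obtain ⟨-, h2⟩ := hFP (embLift F F.val) fun x hx ↦ embLift_apply F F.val ⟨x, hx⟩
    rw [if_pos (h2 r)] at h0
    exact hc0 _ _ h0
  choose α hα using hα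
  let a (j : I) : F := if j = rep j then α j else 0
  let g (j : I) (σ : Gal(Ω/L)) : Ω := c σ j * σ (a (σ⁻¹ • j))
  have hg (j : I) (σ τ) (hτ : ∀ x ∈ F, τ x = x) : g j (σ * τ) = g j σ := by
    obtain ⟨h1, h2⟩ := hFP τ hτ
    have h3 : τ⁻¹ • σ⁻¹ • j = σ⁻¹ • j := by rw [inv_smul_eq_iff, h2]
    simp only [g, hc, h1, mul_inv_rev, mul_smul, h3, AlgEquiv.mul_apply, hτ _ (SetLike.coe_mem _)]
    simp
  have hgτ (j : I) (σ τ) : g j (τ * σ) = c τ j * τ (g (τ⁻¹ • j) σ) := by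
    simp only [g, hc, mul_inv_rev, mul_smul, map_mul, AlgEquiv.mul_apply, mul_assoc]
  let β (j : I) : Ω := ∑ φ : F →ₐ[L] Ω, g j (embLift F φ)
  have hβ (τ j) : β j = c τ j * τ (β (τ⁻¹ • j)) := by
    simp only [β]
    rw [← sum_embLift_mul F (hg j) τ, map_sum, Finset.mul_sum]
    simp only [hgτ]
  have hβrep (j : I) (hj : j = rep j) : β j ≠ 0 := by
    convert hα j using 1
    refine Finset.sum_congr rfl fun φ _ ↦ ?_
    by_cases h : embLift F φ • j = j
    · have h' : (embLift F φ)⁻¹ • j = j := by rw [inv_smul_eq_iff, h]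
      simp only [g, h', if_pos h, a, if_pos hj]
      rw [embLift_apply]
    · have h' : (embLift F φ)⁻¹ • j ≠ j := fun h' ↦ h (by rw [inv_smul_eq_iff] at h'; exact h'.symm)
      have h'' : (embLift F φ)⁻¹ • j ≠ rep ((embLift F φ)⁻¹ • j) := by
        rw [hrep', ← hj]
        exact h'
      simp [g, a, if_neg h, if_neg h'']
  have hβ0 (j : I) : β j ≠ 0 := by
    obtain ⟨τ, hτ⟩ := hrep j
    have h1 : rep j = rep (rep j) := by conv_lhs => rw [← hτ, hrep']
    rw [hβ τ j, show τ⁻¹ • j = rep j by rw [inv_smul_eq_iff, hτ]]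
    exact mul_ne_zero (hc0 _ _) ((map_ne_zero τ).2 (hβrep _ h1))
  refine ⟨fun j ↦ (β j)⁻¹, fun j ↦ inv_ne_zero (hβ0 j), fun σ j ↦ ?_⟩
  rw [map_inv₀, div_inv_eq_mul, hβ σ j, ← mul_assoc, mul_comm _ (c σ j), mul_assoc,
    inv_mul_cancel₀ ((map_ne_zero σ).2 (hβ0 _)), mul_one]

end Hilbert90

/-! ### Galois action on points and characters -/

section GaloisAction
open Topology groupCohomology
variable {K : Type*} [Field K] {B C : Type*} [CommRing B] [CommRing C] [HopfAlgebra K B]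
  [HopfAlgebra K C] [Coalgebra.IsCocomm K B] [Coalgebra.IsCocomm K C]
  {E : Type*} [Field E] [Algebra K E] [Normal K E]
  {L Ω : Type*} [Field L] [Field Ω] [Algebra K L] [Algebra L Ω] [Algebra K Ω]
  [IsScalarTower K L Ω]
omit [Coalgebra.IsCocomm K B] in
theorem eventually_tensorMap_eq [Algebra.IsAlgebraic L Ω] (ι : E →ₐ[K] Ω) (t : E ⊗[K] B) :
    ∀ᶠ τ in 𝓝 (1 : Gal(Ω/L)),
      Algebra.TensorProduct.map (galRes ι τ : E →ₐ[K] E) (AlgHom.id K B) t = t := by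
  induction t with
  | zero => simp
  | add x y hx hy =>
    filter_upwards [hx, hy] with τ hx hy
    rw [map_add, hx, hy]
  | tmul s b =>
    filter_upwards [eventually_galois_apply_eq (ι s)] with τ hτ
    have : galRes ι τ s = s := ι.injective ((galRes_apply ι τ s).trans hτ)
    simp [this]
/-- An automorphism fixes a point as soon as it fixes generators of the character group together
with the values of these generators at the point. -/
theorem smul_eq_of_span_eq_top (ι : E →ₐ[K] Ω) (hB : IsDiagonalizableOver K B E)
    {S : Set (Additive (CharGroup K B E))} (hS : Submodule.span ℤ S = ⊤) (f : Points K B Ω)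
    (τ : Gal(Ω/L)) (h1 : ∀ y ∈ S, Algebra.TensorProduct.map (galRes ι τ : E →ₐ[K] E)
      (AlgHom.id K B) y.toMul.val = y.toMul.val)
    (h2 : ∀ y ∈ S, τ (charEval B ι f y.toMul) = charEval B ι f y.toMul) : τ • f = f := by
  have key : (charEval B ι (τ • f)).toHomUnits = (charEval B ι f).toHomUnits := by
    refine MonoidHom.toAdditive.injective <| AddMonoidHom.toIntLinearMap_injective <|
      LinearMap.ext_on hS fun y hy ↦ congrArg Additive.ofMul (Units.ext ?_)
    change evalAt ι (τ • f) y.toMul.val = charEval B ι f y.toMul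
    conv_lhs => rw [← h1 y hy, evalAt_galois, ← charEval_apply, h2 y hy]
  refine (charEval_bijective hB ι).1 (MonoidHom.ext fun x ↦ ?_)
  exact congrArg Units.val (DFunLike.congr_fun key x)
/-- The Galois module of points of a diagonalizable group of finite type is discrete. -/
theorem eventually_smul_eq [Algebra.IsAlgebraic L Ω] (ι : E →ₐ[K] Ω)
    (hB : IsDiagonalizableOver K B E) [Module.Finite ℤ (Additive (CharGroup K B E))]
    (f : Points K B Ω) : ∀ᶠ τ in 𝓝 (1 : Gal(Ω/L)), τ • f = f := by
  obtain ⟨S, hS⟩ := ‹Module.Finite ℤ (Additive (CharGroup K B E))›.fg_top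
  have h1 := (Filter.eventually_all_finset S).2 fun y _ ↦
    (eventually_tensorMap_eq (L := L) ι y.toMul.val).and
      (eventually_galois_apply_eq (charEval B ι f y.toMul))
  filter_upwards [h1] with τ hτ
  exact smul_eq_of_span_eq_top ι hB hS f τ (fun y hy ↦ (hτ y hy).1) fun y hy ↦ (hτ y hy).2
variable (L) in
/-- The basis `b` of the character group is permuted by the Galois group of `Ω / L`, which acts on
characters over `E` through the embedding `ι`. -/
def IsPermBasis (ι : E →ₐ[K] Ω) {I : Type*} [MulAction Gal(Ω/L) I]
    (b : Module.Basis I ℤ (Additive (CharGroup K C E))) : Prop :=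
  ∀ (τ : Gal(Ω/L)) (j : I),
    Algebra.TensorProduct.map (galRes ι τ : E →ₐ[K] E) (AlgHom.id K C) (b j).toMul.val =
      (b (τ • j)).toMul.val
variable {ι : E →ₐ[K] Ω} {I : Type*} [MulAction Gal(Ω/L) I]
  {b : Module.Basis I ℤ (Additive (CharGroup K C E))}
theorem IsPermBasis.charEval_smul (hb : IsPermBasis L ι b) (τ : Gal(Ω/L)) (p : Points K C Ω)
    (j : I) : charEval C ι (τ • p) (b j).toMul = τ (charEval C ι p (b (τ⁻¹ • j)).toMul) := by
  have := hb τ (τ⁻¹ • j)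
  rw [smul_inv_smul] at this
  rw [charEval_apply, charEval_apply, ← this, evalAt_galois]
omit [Coalgebra.IsCocomm K C] in
theorem IsPermBasis.eventually_smul_eq [Algebra.IsAlgebraic L Ω] (hb : IsPermBasis L ι b) (j : I) :
    ∀ᶠ τ in 𝓝 (1 : Gal(Ω/L)), τ • j = j := by
  filter_upwards [eventually_tensorMap_eq ι (b j).toMul.val] with τ hτ
  exact b.injective (Additive.toMul.injective (GroupLike.val_injective ((hb τ j).symm.trans hτ)))
/-- The first cohomology group of a quasi-trivial torus vanishes. -/
theorem IsPermBasis.isMulCoboundary [Normal L Ω] [Finite I] (hC : IsDiagonalizableOver K C E)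
    (hb : IsPermBasis L ι b) (c : Z1 Gal(Ω/L) (Points K C Ω)) : IsMulCoboundary₁ c.1 := by
  have hc1 : c.1 1 = 1 := map_one_of_isMulCocycle₁ c.2.1
  obtain ⟨β, hβ0, hβ⟩ := exists_coboundary_of_permutation hb.eventually_smul_eq
    (fun σ j ↦ charEval C ι (c.1 σ) (b j).toMul) (fun σ j ↦ charEval_ne_zero ι _ _)
    (fun σ τ j ↦ by
      rw [c.2.1 σ τ, map_mul, MonoidHom.mul_apply, hb.charEval_smul, mul_comm])
    (by
      filter_upwards [c.2.2.eventually_eq 1] with τ hτ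
      rw [hτ, hc1, map_one]
      rfl)
  obtain ⟨y, hy⟩ := exists_point_of_basis hC b ι fun j ↦ Units.mk0 (β j) (hβ0 j)
  refine ⟨y, fun σ ↦ charEval_ext_of_basis hC b ι fun j ↦ ?_⟩
  have h1 := hβ σ j
  rw [eq_div_iff (hβ0 j)] at h1
  rw [← mul_left_inj' (charEval_ne_zero ι y (b j).toMul), ← MonoidHom.mul_apply, ← map_mul,
    div_mul_cancel, hb.charEval_smul, hy, hy]
  exact h1.symm

end GaloisAction

/-! ### The permutation action on a basis of characters -/

section PermAction
variable {K : Type*} [Field K] {C : Type*} [CommRing C] [HopfAlgebra K C]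
  {E : Type*} [Field E] [Algebra K E] {n : ℕ}
  (b : Module.Basis (Fin n) ℤ (Additive (GroupLike E (E ⊗[K] C))))
  (hb : ∀ (σ : Gal(E/K)) (i : Fin n), ∃ j : Fin n,
    Algebra.TensorProduct.map (σ : E →ₐ[K] E) (AlgHom.id K C) (b i).toMul.val = (b j).toMul.val)
/-- The action of the Galois group on the indices of a permutation basis. -/
@[reducible]
def permAction : MulAction Gal(E/K) (Fin n) where
  smul σ i := (hb σ i).choose
  one_smul i := by
    refine b.injective (Additive.toMul.injective (GroupLike.val_injective ?_))
    refine (hb 1 i).choose_spec.symm.trans ?_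
    change Algebra.TensorProduct.map (AlgHom.id K E) (AlgHom.id K C) _ = _
    rw [Algebra.TensorProduct.map_id]
    rfl
  mul_smul σ τ i := by
    refine b.injective (Additive.toMul.injective (GroupLike.val_injective ?_))
    refine (hb (σ * τ) i).choose_spec.symm.trans
      (Eq.trans ?_ (hb σ (hb τ i).choose).choose_spec)
    rw [← (hb τ i).choose_spec]
    change Algebra.TensorProduct.map ((σ : E →ₐ[K] E).comp (τ : E →ₐ[K] E))
      ((AlgHom.id K C).comp (AlgHom.id K C)) _ = _
    rw [Algebra.TensorProduct.map_comp]
    rfl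
theorem tensorMap_permAction (σ : Gal(E/K)) (i : Fin n) :
    Algebra.TensorProduct.map (σ : E →ₐ[K] E) (AlgHom.id K C) (b i).toMul.val =
      (b ((permAction b hb).smul σ i)).toMul.val :=
  (hb σ i).choose_spec

end PermAction

/-! ### Local lifting of rational points -/

section LocalRoots
open Polynomial Topology
/-- A polynomial with nonzero derivative at `0` is open at `0` over a complete field. -/
theorem exists_eval_eq_of_near {𝕜 : Type*} [NontriviallyNormedField 𝕜] [CompleteSpace 𝕜]
    (g : 𝕜[X]) (hg : g.derivative.eval 0 ≠ 0) {δ : ℝ} (hδ : 0 < δ) :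
    ∃ ε > 0, ∀ t, ‖t - g.eval 0‖ < ε → ∃ x, ‖x‖ < δ ∧ g.eval x = t := by
  have h := (g.hasStrictDerivAt 0).map_nhds_eq hg
  have h1 : (fun x ↦ g.eval x) '' Metric.ball 0 δ ∈ 𝓝 (g.eval 0) := by
    rw [← h]
    exact Filter.image_mem_map (Metric.ball_mem_nhds 0 hδ)
  obtain ⟨ε, hε, hsub⟩ := Metric.mem_nhds_iff.1 h1
  refine ⟨ε, hε, fun t ht ↦ ?_⟩
  obtain ⟨x, hx, rfl⟩ := hsub (mem_ball_iff_norm.2 ht)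
  exact ⟨x, mem_ball_zero_iff.1 hx, rfl⟩
/-- A polynomial with nonzero derivative at `0` is injective near `0`. -/
theorem exists_pos_injOn_eval {𝕜 : Type*} [NontriviallyNormedField 𝕜]
    (g : 𝕜[X]) (hg : g.derivative.eval 0 ≠ 0) :
    ∃ δ > 0, ∀ x y : 𝕜, ‖x‖ < δ → ‖y‖ < δ → g.eval x = g.eval y → x = y := by
  have h := ((g.hasStrictDerivAt 0).hasStrictFDerivAt.isLittleO).def
    (half_pos (norm_pos_iff.2 hg))
  obtain ⟨δ, hδ, hball⟩ := Metric.eventually_nhds_iff_ball.1 h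
  refine ⟨δ, hδ, fun x y hx hy hxy ↦ ?_⟩
  have h1 := hball (x, y) (by
    rw [← ball_prod_same]
    exact ⟨mem_ball_zero_iff.2 hx, mem_ball_zero_iff.2 hy⟩)
  simp only [hxy, sub_self, zero_sub, norm_neg] at h1
  simp only [ContinuousLinearMap.toSpanSingleton_apply, smul_eq_mul, norm_mul] at h1
  by_contra hne
  have h2 : 0 < ‖x - y‖ := norm_pos_iff.2 (sub_ne_zero.2 hne)
  have h3 : 0 < ‖g.derivative.eval 0‖ := norm_pos_iff.2 hg
  nlinarith
variable {k Ω : Type*} [NontriviallyNormedField k] [CompleteSpace k] [IsUltrametricDist k]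
  [Field Ω] [Algebra k Ω] [Algebra.IsAlgebraic k Ω]
/-- A polynomial over `k` with nonzero derivative at `0` solves `g x = t` in every finite
subextension `F` that contains `t`, for `t` close to `g 0`; the small solution is unique in `Ω`. The
radius of uniqueness is chosen first, in `Ω`, and the complete field `F` then supplies the solution
within this radius. -/
theorem exists_root_near (F : IntermediateField k Ω) [FiniteDimensional k F] (g : k[X])
    (hg : g.derivative.eval 0 ≠ 0) :
    ∃ ε > 0, ∃ δ > 0,
      (∀ t ∈ F, spectralNorm k Ω (t - algebraMap k Ω (g.eval 0)) < ε →
        ∃ x, spectralNorm k Ω x < δ ∧ aeval x g = t) ∧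
      ∀ x y : Ω, spectralNorm k Ω x < δ → spectralNorm k Ω y < δ → aeval x g = aeval y g →
        x = y := by
  obtain ⟨δ, hδ, h1⟩ : ∃ δ > 0, ∀ x y : Ω, spectralNorm k Ω x < δ → spectralNorm k Ω y < δ →
      aeval x g = aeval y g → x = y := by
    let : NontriviallyNormedField Ω := spectralNorm.nontriviallyNormedField k Ω
    obtain ⟨δ, hδ, h⟩ := exists_pos_injOn_eval (g.map (algebraMap k Ω)) (by
      rw [derivative_map, ← map_zero (algebraMap k Ω), eval_map_apply, map_zero]
      exact fun h ↦ hg ((algebraMap k Ω).injective (h.trans (map_zero _).symm)))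
    refine ⟨δ, hδ, fun x y hx hy hxy ↦ h x y hx hy ?_⟩
    rwa [eval_map_algebraMap, eval_map_algebraMap]
  obtain ⟨ε, hε, h2⟩ : ∃ ε > 0, ∀ t : F, spectralNorm k F (t - algebraMap k F (g.eval 0)) < ε →
      ∃ x : F, spectralNorm k F x < δ ∧ aeval x g = t := by
    let : NontriviallyNormedField F := spectralNorm.nontriviallyNormedField k F
    have : CompleteSpace F := spectralNorm.completeSpace k F
    obtain ⟨ε, hε, h⟩ := exists_eval_eq_of_near (g.map (algebraMap k F)) (by
      rw [derivative_map, ← map_zero (algebraMap k F), eval_map_apply, map_zero]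
      exact fun h ↦ hg ((algebraMap k F).injective (h.trans (map_zero _).symm))) hδ
    refine ⟨ε, hε, fun t ht ↦ ?_⟩
    obtain ⟨x, hx, hxt⟩ := h t (by
      rw [← map_zero (algebraMap k F), eval_map_apply]
      exact ht)
    exact ⟨x, hx, by rwa [eval_map_algebraMap] at hxt⟩
  refine ⟨ε, hε, δ, hδ, fun t ht hε ↦ ?_, h1⟩
  obtain ⟨x, hx, hxt⟩ := h2 ⟨t, ht⟩ (by
    rw [spectralNorm.eq_of_tower (L := Ω)]
    exact hε)
  refine ⟨x, ?_, ?_⟩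
  · rwa [spectralNorm.eq_of_tower (L := Ω)] at hx
  · exact (aeval_algebraMap_apply Ω x g).trans (congrArg (algebraMap F Ω) hxt)

end LocalRoots

section NormPolynomial
open Polynomial
variable {k Ω : Type*} [Field k] [Field Ω] [Algebra k Ω] [IsGalois k Ω]
theorem mem_range_algebraMap_of_galois_fixed {x : Ω} (hx : ∀ τ : Gal(Ω/k), τ x = x) :
    x ∈ (algebraMap k Ω).range := by
  have h : x ∈ IntermediateField.fixedField (⊤ : Subgroup Gal(Ω/k)) := fun τ ↦ hx τ
  rw [← IntermediateField.fixingSubgroup_bot, InfiniteGalois.fixedField_fixingSubgroup] at h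
  exact IntermediateField.mem_bot.1 h
theorem mem_of_galois_fixed (F : IntermediateField k Ω) {x : Ω}
    (hx : ∀ τ : Gal(Ω/k), (∀ y ∈ F, τ y = y) → τ x = x) : x ∈ F := by
  rw [← InfiniteGalois.fixedField_fixingSubgroup F]
  exact fun τ ↦ hx τ.1 ((IntermediateField.mem_fixingSubgroup_iff _ _).1 τ.2)
/-- A finite separable extension has an element of trace `1`. -/
theorem exists_sum_embeddings_eq_one (F : IntermediateField k Ω) [FiniteDimensional k F] :
    ∃ a : F, ∑ φ : F →ₐ[k] Ω, φ a = 1 := by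
  obtain ⟨a, ha⟩ : ∃ a : F, ∑ φ : F →ₐ[k] Ω, φ a ≠ 0 := by
    by_contra! h
    have hli : LinearIndependent Ω (fun φ : F →ₐ[k] Ω ↦ ((φ : F →* Ω) : F → Ω)) :=
      (linearIndependent_monoidHom F Ω).comp (fun φ : F →ₐ[k] Ω ↦ (φ : F →* Ω))
        fun φ ψ hφ ↦ AlgHom.ext fun x ↦ DFunLike.congr_fun hφ x
    refine one_ne_zero (Fintype.linearIndependent_iff.1 hli (fun _ ↦ 1) (funext fun x ↦ ?_) F.val)
    rw [Finset.sum_apply]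
    simpa using h x
  obtain ⟨c, hc⟩ := mem_range_algebraMap_of_galois_fixed (k := k) (x := ∑ φ : F →ₐ[k] Ω, φ a)
    fun τ ↦ by
      have := sum_embLift_mul F (h := fun σ : Gal(Ω/k) ↦ σ a)
        (fun σ τ hτ ↦ by simp [hτ _ a.2]) τ
      simpa [embLift_apply] using this
  refine ⟨c⁻¹ • a, ?_⟩
  simp only [map_smul, ← Finset.smul_sum, ← hc]
  rw [Algebra.smul_def, ← map_mul, inv_mul_cancel₀, map_one]
  rintro rfl
  exact ha (by rw [← hc, map_zero])
/-- For `a` of trace `1`, the norm of `(1 + a X) ^ d` is a polynomial over the ground field with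
derivative `d` at `0`. -/
theorem exists_norm_polynomial (F : IntermediateField k Ω) [FiniteDimensional k F] (d : ℕ)
    {a : F} (ha : ∑ φ : F →ₐ[k] Ω, φ a = 1) :
    ∃ g : k[X], g.eval 0 = 1 ∧ g.derivative.eval 0 = d ∧
      ∀ x : Ω, aeval x g = ∏ φ : F →ₐ[k] Ω, (1 + φ a * x) ^ d := by
  classical
  let P : Polynomial Ω := ∏ φ : F →ₐ[k] Ω, (1 + C (φ a) * X)
  have hP (τ : Gal(Ω/k)) : P.map (τ : Ω →+* Ω) = P := by
    have := prod_embLift_mul F (h := fun σ : Gal(Ω/k) ↦ (1 + C (σ a) * X : Polynomial Ω))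
      (fun σ τ hτ ↦ by simp [hτ _ a.2]) τ
    simpa [embLift_apply, P, Polynomial.map_prod] using this
  obtain ⟨g, hg⟩ : ∃ g : k[X], g.map (algebraMap k Ω) = P := by
    refine (lifts_iff_coeff_lifts P).2 fun n ↦ ?_
    refine mem_range_algebraMap_of_galois_fixed fun τ ↦ ?_
    conv_rhs => rw [← hP τ, coeff_map]
    rfl
  have h0 : g.eval 0 = 1 := by
    apply (algebraMap k Ω).injective
    rw [← eval_map_apply, hg, map_zero, map_one]
    simp [P, eval_prod]
  have h1 : g.derivative.eval 0 = 1 := by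
    apply (algebraMap k Ω).injective
    rw [← eval_map_apply, ← derivative_map, hg, map_zero, map_one, ← ha]
    have : derivative P = ∑ φ : F →ₐ[k] Ω,
        (∏ ψ ∈ Finset.univ.erase φ, (1 + C (ψ a) * X)) * derivative (1 + C (φ a) * X) :=
      derivative_prod_finset
    rw [this, eval_finsetSum]
    refine Finset.sum_congr rfl fun φ _ ↦ ?_
    simp [eval_prod]
  refine ⟨g ^ d, by simp [h0], by simp [derivative_pow, h0, h1], fun x ↦ ?_⟩
  rw [map_pow, ← eval_map_algebraMap, hg, eval_prod, ← Finset.prod_pow]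
  simp

end NormPolynomial

section LocalLifting
variable {K : Type*} [Field K] {B C : Type*} [CommRing B] [CommRing C] [HopfAlgebra K B]
  [HopfAlgebra K C] [Coalgebra.IsCocomm K B] [Coalgebra.IsCocomm K C] {q : C →ₐc[K] B}
  {E : Type*} [Field E] [Algebra K E] [Normal K E]
  {k Ω : Type*} [NontriviallyNormedField k] [CompleteSpace k] [IsUltrametricDist k]
  [Field Ω] [Algebra K k] [Algebra k Ω] [Algebra K Ω] [IsScalarTower K k Ω] [IsGalois k Ω]
/-- A rational point of a quasi-trivial torus over a complete field that is close to `1` lifts to a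
rational point of the torus `Spec B`.
If `a` has trace `1`, the norm `g(x)` of `(1 + a x) ^ d` is a polynomial in `x` over the ground
field with nonzero derivative at `0`, so a point with coordinates `t j` close to `1` can be written
with coordinates `g (x j)`, and the small roots `x j` are permuted by the Galois group. The point
with coordinates `(1 + a * x j) ^ d` over the splitting field lifts to `Spec B`, and the norm of
the lift is the required rational point. -/
theorem exists_fixed_lift_of_near_one (ι : E →ₐ[K] Ω)
    (hB : IsDiagonalizableOver K B E) (hC : IsDiagonalizableOver K C E)
    [Module.Finite ℤ (Additive (CharGroup K B E))] {I : Type*} [Finite I] [MulAction Gal(Ω/k) I]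
    {b : Module.Basis I ℤ (Additive (CharGroup K C E))} (hb : IsPermBasis k ι b)
    {s : CharGroup K B E →* CharGroup K C E} {d : ℕ} (hd : (d : K) ≠ 0)
    (hs : ∀ x, s (charMap E q x) = x ^ d) :
    ∃ ε > 0, ∀ p : Points K C Ω, (∀ τ : Gal(Ω/k), τ • p = p) →
      (∀ j, spectralNorm k Ω (charEval C ι p (b j).toMul - 1) < ε) →
      ∃ f : Points K B Ω, (∀ τ : Gal(Ω/k), τ • f = f) ∧ Points.comap K Ω q f = p := by
  obtain ⟨S, hS⟩ := ‹Module.Finite ℤ (Additive (CharGroup K B E))›.fg_top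
  obtain ⟨F, hF, hFP⟩ := exists_finiteDimensional_of_eventually
    ((Filter.eventually_all.2 fun j ↦ hb.eventually_smul_eq j).and
    ((Filter.eventually_all_finset S).2 fun y _ ↦
      eventually_tensorMap_eq (L := k) ι y.toMul.val))
  obtain ⟨a, ha⟩ := exists_sum_embeddings_eq_one F
  obtain ⟨g, hg0, hg1, hg⟩ := exists_norm_polynomial F d ha
  have hd0 : d ≠ 0 := by rintro rfl; simp at hd
  obtain ⟨ε, hε, δ, -, hroot, hinj⟩ := exists_root_near (Ω := Ω) F g (by
    rw [hg1]
    simpa using (map_ne_zero (algebraMap K k)).2 hd)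
  refine ⟨ε, hε, fun p hp hpε ↦ ?_⟩
  have hτ (τ : Gal(Ω/k)) (j : I) :
      τ (charEval C ι p (b j).toMul) = charEval C ι p (b (τ • j)).toMul := by
    conv_rhs => rw [← hp τ, hb.charEval_smul, inv_smul_smul]
  choose x hxδ hx using fun j ↦ hroot (charEval C ι p (b j).toMul)
    (mem_of_galois_fixed F fun τ h ↦ by rw [hτ, (hFP τ h).1 j])
    (by rw [hg0, map_one]; exact hpε j)
  -- The small roots are permuted by the Galois group, because the coordinates of `p` are.
  have hxτ (τ : Gal(Ω/k)) (j : I) : τ (x j) = x (τ • j) := by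
    refine hinj _ _ ?_ (hxδ _) ?_
    · rw [← spectralNorm_eq_of_equiv]
      exact hxδ j
    · rw [hx, ← hτ, ← hx]
      exact Polynomial.aeval_algHom_apply (τ : Ω →ₐ[k] Ω) (x j) g
  have hu (j : I) : 1 + a * x j ≠ 0 := by
    intro h0
    refine charEval_ne_zero ι p (b j).toMul ?_
    rw [← hx j, hg]
    exact Finset.prod_eq_zero (Finset.mem_univ F.val) (by
      rw [← zero_pow hd0]
      exact congrArg (· ^ d) h0)
  obtain ⟨p', hp'⟩ := exists_point_of_basis hC b ι fun j ↦ Units.mk0 _ (hu j)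
  obtain ⟨f', hf', hf's⟩ := exists_comap_eq_pow hB hC hs ι p'
  have hfix (τ : Gal(Ω/k)) (h : ∀ y ∈ F, τ y = y) : τ • f' = f' := by
    obtain ⟨h1, h2⟩ := hFP τ h
    refine smul_eq_of_span_eq_top ι hB hS f' τ h2 fun y _ ↦ ?_
    have key : (τ : Ω →* Ω).comp (charEval C ι p') = charEval C ι p' :=
      charGroup_hom_ext_of_basis b fun j ↦ by
        change τ (charEval C ι p' (b j).toMul) = _
        rw [hp']
        simp [hxτ, h1, h _ a.2]
    rw [hf's]
    exact DFunLike.congr_fun key _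
  have hinv (σ τ : Gal(Ω/k)) (h : ∀ y ∈ F, τ y = y) : (σ * τ) • f' = σ • f' := by
    rw [mul_smul, hfix τ h]
  refine ⟨∏ φ : F →ₐ[k] Ω, embLift F φ • f', fun τ ↦ ?_, ?_⟩
  · rw [Finset.smul_prod']
    refine Eq.trans ?_ (prod_embLift_mul F (h := fun σ ↦ σ • f') hinv τ)
    simp only [mul_smul]
  · refine charEval_ext_of_basis hC b ι fun j ↦ ?_
    rw [map_prod, map_prod, MonoidHom.finsetProd_apply, ← hx j, hg]
    refine Finset.prod_congr rfl fun φ _ ↦ ?_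
    change charEval C ι (embLift F φ • Points.comap K Ω q f') _ = _
    rw [hf', hb.charEval_smul, map_pow, MonoidHom.pow_apply, hp']
    simp [hxτ, embLift_apply]

end LocalLifting

/-! ### Galois descent for permutation modules -/

section Descent
open Topology
variable {K E : Type*} [Field K] [Field E] [Algebra K E] [IsGalois K E]
/-- Galois descent: the vectors in `I → E` fixed by the twisted Galois action, which permutes the
indices as well, span this space over `E`. -/
theorem span_fixed_eq_top {I : Type*} [Finite I] [MulAction Gal(E/K) I]
    (hI : ∀ j : I, ∀ᶠ τ in 𝓝 (1 : Gal(E/K)), τ • j = j) :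
    Submodule.span E {t : I → E | ∀ (τ : Gal(E/K)) i, τ (t i) = t (τ • i)} = ⊤ := by
  classical
  obtain ⟨F, hF, hFP⟩ := exists_finiteDimensional_of_eventually (Filter.eventually_all.2 hI)
  by_contra hne
  obtain ⟨f, hf0, hf⟩ := Submodule.exists_le_ker_of_lt_top _ (lt_top_iff_ne_top.2 hne)
  refine hf0 (LinearMap.pi_ext' fun j ↦ LinearMap.ext_ring ?_)
  -- The trace of `a` times the `j`-th basis vector is fixed, so `f` kills it.
  have htr (a : F) : ∑ φ : F →ₐ[K] E, φ a * f (Pi.single (embLift F φ • j) 1) = 0 := by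
    let h (i : I) (σ : Gal(E/K)) : E := if σ • j = i then σ a else 0
    have hh (i : I) (σ τ) (hτ : ∀ x ∈ F, τ x = x) : h i (σ * τ) = h i σ := by
      simp [h, mul_smul, hFP τ hτ j, hτ _ a.2]
    have hmem : (fun i ↦ ∑ φ : F →ₐ[K] E, h i (embLift F φ)) ∈
        {t : I → E | ∀ (τ : Gal(E/K)) i, τ (t i) = t (τ • i)} := by
      intro τ i
      change _ = ∑ φ : F →ₐ[K] E, h (τ • i) (embLift F φ)
      rw [← sum_embLift_mul F (hh (τ • i)) τ, map_sum]
      refine Finset.sum_congr rfl fun φ _ ↦ ?_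
      simp only [h, mul_smul, smul_left_cancel_iff, AlgEquiv.mul_apply]
      split_ifs <;> simp
    have h0 : f (fun i ↦ ∑ φ : F →ₐ[K] E, h i (embLift F φ)) = 0 :=
      hf (Submodule.subset_span hmem)
    rw [← h0, ← Finset.sum_fn, map_sum]
    refine Finset.sum_congr rfl fun φ _ ↦ ?_
    rw [← smul_eq_mul, ← map_smul]
    congr 1
    ext i
    simp [h, Pi.single_apply, embLift_apply, eq_comm]
  have hli : LinearIndependent E (fun φ : F →ₐ[K] E ↦ ((φ : F →* E) : F → E)) :=
    (linearIndependent_monoidHom F E).comp (fun φ : F →ₐ[K] E ↦ (φ : F →* E))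
      fun φ ψ hφ ↦ AlgHom.ext fun x ↦ DFunLike.congr_fun hφ x
  have h1 := Fintype.linearIndependent_iff.1 hli
    (fun φ ↦ f (Pi.single (embLift F φ • j) 1)) (funext fun x ↦ by
      rw [Finset.sum_apply, Pi.zero_apply, ← htr x]
      exact Finset.sum_congr rfl fun φ _ ↦ mul_comm _ _) F.val
  rw [hFP _ (fun x hx ↦ embLift_apply F F.val ⟨x, hx⟩) j] at h1
  simpa using h1
/-- The vectors `w m` form a basis of `I → E` fixed by the twisted action of the Galois group; the
numbers `c i m` are the coordinates of the standard basis vectors. -/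
theorem exists_fixed_basis {I : Type*} [Fintype I] [DecidableEq I] [MulAction Gal(E/K) I]
    (hI : ∀ j : I, ∀ᶠ τ in 𝓝 (1 : Gal(E/K)), τ • j = j) :
    ∃ (n : ℕ) (w : Fin n → I → E) (c : I → Fin n → E),
      (∀ (τ : Gal(E/K)) m i, τ (w m i) = w m (τ • i)) ∧
      (∀ (τ : Gal(E/K)) i m, τ (c i m) = c (τ • i) m) ∧
      ∀ i i', ∑ m, c i m * w m i' = if i = i' then 1 else 0 := by
  obtain ⟨J, B, hBmem⟩ : ∃ (J : Type _) (B : Module.Basis J E (I → E)),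
      Set.range B ⊆ {t : I → E | ∀ (τ : Gal(E/K)) i, τ (t i) = t (τ • i)} :=
    ⟨_, _, Module.Basis.ofSpan_subset (span_fixed_eq_top hI).ge⟩
  have := Module.Finite.finite_basis B
  obtain ⟨n, B, hBmem⟩ : ∃ (n : ℕ) (B : Module.Basis (Fin n) E (I → E)),
      Set.range B ⊆ {t : I → E | ∀ (τ : Gal(E/K)) i, τ (t i) = t (τ • i)} :=
    ⟨_, B.reindex (Finite.equivFin J), by rwa [Module.Basis.range_reindex]⟩
  have hB (τ : Gal(E/K)) (m) (i : I) : τ (B m i) = B m (τ • i) :=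
    hBmem ⟨m, rfl⟩ τ i
  refine ⟨n, fun m ↦ B m, fun i m ↦ B.repr (Pi.single i 1) m, hB, fun τ i m ↦ ?_,
    fun i i' ↦ ?_⟩
  · have h1 (i : I) := B.sum_repr (Pi.single i 1)
    have h2 : ∑ m, τ (B.repr (Pi.single i 1) m) • B m = Pi.single (τ • i) 1 := by
      ext i'
      have := congrArg τ (congrFun (h1 i) (τ⁻¹ • i'))
      rw [Finset.sum_apply, map_sum] at this
      simp only [Pi.smul_apply, smul_eq_mul, map_mul, hB, smul_inv_smul] at this
      rw [Finset.sum_apply]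
      simp only [Pi.smul_apply, smul_eq_mul, this, Pi.single_apply]
      rw [apply_ite τ, map_one, map_zero]
      simp only [inv_smul_eq_iff]
    change _ = B.repr (Pi.single (τ • i) 1) m
    rw [← h2, B.repr_sum_self]
  · have := congrFun (B.sum_repr (Pi.single i 1)) i'
    rw [Finset.sum_apply] at this
    simpa [Pi.single_apply, eq_comm] using this
/-- Over an extension `Ω / L`, a vector that is compatible with the Galois action has coordinates in
`L` with respect to a Galois-fixed basis. -/
theorem exists_coords_of_fixed {I J : Type*} [Fintype I] [DecidableEq I] [Fintype J]
    [MulAction Gal(E/K) I]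
    {w : J → I → E} {c : I → J → E} (hc : ∀ (τ : Gal(E/K)) i m, τ (c i m) = c (τ • i) m)
    (hcw : ∀ i i', ∑ m, c i m * w m i' = if i = i' then 1 else 0)
    {L Ω : Type*} [Field L] [Field Ω] [Algebra K L] [Algebra L Ω] [Algebra K Ω]
    [IsScalarTower K L Ω] [IsGalois L Ω] (ι : E →ₐ[K] Ω) {t : I → Ω}
    (ht : ∀ (τ : Gal(Ω/L)) i, τ (t i) = t (galRes ι τ • i)) :
    ∃ y : J → L, ∀ i, t i = ∑ m, algebraMap L Ω (y m) * ι (w m i) := by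
  -- The coordinates are obtained by applying the dual basis `c`.
  have hfix (m : J) (τ : Gal(Ω/L)) : τ (∑ i, t i * ι (c i m)) = ∑ i, t i * ι (c i m) := by
    rw [map_sum]
    refine Fintype.sum_equiv (MulAction.toPerm (galRes ι τ)) _ _ fun i ↦ ?_
    rw [map_mul, ht, ← galRes_apply, hc]
    rfl
  choose y hy using fun m ↦ mem_range_algebraMap_of_galois_fixed (hfix m)
  refine ⟨y, fun i' ↦ ?_⟩
  simp only [hy, Finset.sum_mul]
  rw [Finset.sum_comm]
  simp only [mul_assoc, ← Finset.mul_sum, ← map_mul, ← map_sum, hcw]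
  simp

end Descent

section LocalNeighbourhood
variable {K : Type*} [Field K] {B C : Type*} [CommRing B] [CommRing C] [HopfAlgebra K B]
  [HopfAlgebra K C] [Coalgebra.IsCocomm K B] [Coalgebra.IsCocomm K C] {q : C →ₐc[K] B}
  {E : Type*} [Field E] [Algebra K E] [Normal K E]
  {k Ω : Type*} [NontriviallyNormedField k] [CompleteSpace k] [IsUltrametricDist k]
  [Field Ω] [Algebra K k] [Algebra k Ω] [Algebra K Ω] [IsScalarTower K k Ω] [IsGalois k Ω]
theorem exists_pos_spectralNorm_div_sub_one_lt {I J : Type*} [Finite I] [Fintype J] (w : J → I → Ω)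
    {t : I → Ω} (ht : ∀ i, t i ≠ 0) (y : J → k)
    (hy : ∀ i, t i = ∑ m, algebraMap k Ω (y m) * w m i) {ε : ℝ} (hε : 0 < ε) :
    ∃ η > 0, ∀ y' : J → k, (∀ m, ‖y' m - y m‖ < η) →
      ∀ i, spectralNorm k Ω ((∑ m, algebraMap k Ω (y' m) * w m i) / t i - 1) < ε := by
  let : NormedField Ω := spectralNorm.normedField k Ω
  let : NormedAlgebra k Ω := spectralNorm.normedAlgebra k Ω
  have hcont (i : I) : Continuous fun y' : J → k ↦
      (∑ m, algebraMap k Ω (y' m) * w m i) / t i - 1 := by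
    have : Continuous (algebraMap k Ω) := continuous_algebraMap k Ω
    fun_prop
  have hev : ∀ᶠ y' in nhds y, ∀ i, ‖(∑ m, algebraMap k Ω (y' m) * w m i) / t i - 1‖ < ε := by
    refine Filter.eventually_all.2 fun i ↦ ?_
    have h0 : ‖(∑ m, algebraMap k Ω (y m) * w m i) / t i - 1‖ < ε := by
      rw [← hy, div_self (ht i), sub_self, norm_zero]
      exact hε
    exact (hcont i).norm.continuousAt.eventually_lt continuousAt_const h0
  obtain ⟨η, hη, hball⟩ := Metric.eventually_nhds_iff.1 hev
  refine ⟨η, hη, fun y' hy' ↦ hball ((dist_pi_lt_iff hη).2 fun m ↦ ?_)⟩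
  rw [dist_eq_norm]
  exact hy' m
/-- Rational points of a quasi-trivial torus with coordinates close to those of a given rational
point differ from it by the image of a rational point of `Spec B`. -/
theorem exists_fixed_lift_div_of_near (ι : E →ₐ[K] Ω)
    (hB : IsDiagonalizableOver K B E) (hC : IsDiagonalizableOver K C E)
    [Module.Finite ℤ (Additive (CharGroup K B E))] {I : Type*} [Finite I] [MulAction Gal(Ω/k) I]
    {b : Module.Basis I ℤ (Additive (CharGroup K C E))} (hb : IsPermBasis k ι b)
    {s : CharGroup K B E →* CharGroup K C E} {d : ℕ} (hd : (d : K) ≠ 0)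
    (hs : ∀ x, s (charMap E q x) = x ^ d) {J : Type*} [Fintype J] (w : J → I → Ω)
    {p : Points K C Ω} (hp : ∀ τ : Gal(Ω/k), τ • p = p) (y : J → k)
    (hy : ∀ i, charEval C ι p (b i).toMul = ∑ m, algebraMap k Ω (y m) * w m i) :
    ∃ η > 0, ∀ y' : J → k, (∀ m, ‖y' m - y m‖ < η) →
      (∀ i, ∑ m, algebraMap k Ω (y' m) * w m i ≠ 0) ∧
      ∀ p' : Points K C Ω, (∀ τ : Gal(Ω/k), τ • p' = p') →
        (∀ i, charEval C ι p' (b i).toMul = ∑ m, algebraMap k Ω (y' m) * w m i) →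
        ∃ f : Points K B Ω, (∀ τ : Gal(Ω/k), τ • f = f) ∧ Points.comap K Ω q f = p' / p := by
  obtain ⟨ε, hε, hlift⟩ := exists_fixed_lift_of_near_one (q := q) ι hB hC hb hd hs
  obtain ⟨η, hη, hnear⟩ := exists_pos_spectralNorm_div_sub_one_lt w
    (fun i ↦ charEval_ne_zero ι p (b i).toMul) y hy (lt_min hε one_pos)
  refine ⟨η, hη, fun y' hy' ↦ ⟨fun i h0 ↦ ?_, fun p' hp' hp'y ↦ ?_⟩⟩
  · have := (hnear y' hy' i).trans_le (min_le_right _ _)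
    rw [h0, zero_div, zero_sub, spectralNorm_neg (Algebra.IsAlgebraic.isAlgebraic _),
      spectralNorm_one] at this
    exact lt_irrefl _ this
  · refine hlift _ (fun τ ↦ by rw [smul_div', hp, hp']) fun i ↦ ?_
    have h1 : charEval C ι (p' / p) (b i).toMul =
        charEval C ι p' (b i).toMul / charEval C ι p (b i).toMul := by
      rw [eq_div_iff (charEval_ne_zero ι p _), ← MonoidHom.mul_apply, ← map_mul, div_mul_cancel]
    rw [h1, hp'y]
    exact (hnear y' hy' i).trans_le (min_le_left _ _)

end LocalNeighbourhood

/-! ### Weak approximation for discrete valuations -/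

section WeakApproximation
theorem le_exp_neg_one_of_lt_one {x : ℤᵐ⁰} (hx : x < 1) : x ≤ WithZero.exp (-1) := by
  rcases eq_or_ne x 0 with rfl | h0
  · exact zero_le
  · rw [← WithZero.exp_log h0] at hx ⊢
    rw [← WithZero.exp_zero, WithZero.exp_lt_exp] at hx
    exact WithZero.exp_le_exp.2 (by lia)
/-- Equivalent valuations that are both onto `ℤᵐ⁰` are equal. -/
theorem valuation_eq_of_lt_one_iff {K : Type*} [Field K] {v w : Valuation K ℤᵐ⁰}
    (hv : Function.Surjective v) (hw : Function.Surjective w) (h : ∀ x, v x < 1 ↔ w x < 1) :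
    v = w := by
  have heq : v.IsEquiv w := Valuation.isEquiv_iff_val_lt_one.2 (h _)
  obtain ⟨π, hπ⟩ := hv (WithZero.exp (-1))
  obtain ⟨ϖ, hϖ⟩ := hw (WithZero.exp (-1))
  have hlt : (WithZero.exp (-1) : ℤᵐ⁰) < 1 := by
    rw [← WithZero.exp_zero, WithZero.exp_lt_exp]; norm_num
  have hwπ : w π = WithZero.exp (-1) := by
    refine le_antisymm (le_exp_neg_one_of_lt_one ((h π).1 (hπ ▸ hlt))) ?_
    rw [← hϖ]
    refine (heq ϖ π).1 (hπ ▸ le_exp_neg_one_of_lt_one ((h ϖ).2 (hϖ ▸ hlt)))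
  ext x
  rcases eq_or_ne x 0 with rfl | h0
  · simp
  -- Compare `x` with the power of the uniformizer that has the same value.
  set n := WithZero.log (v x) with hn
  have hvx : v x = v (π ^ (-n)) := by
    rw [map_zpow₀, hπ, ← WithZero.exp_zsmul, ← WithZero.exp_log (v.ne_zero_iff.2 h0), ← hn]
    congr 1
    simp
  have hwx : w x = w (π ^ (-n)) := heq.eq_iff.1 hvx
  rw [hvx, hwx, map_zpow₀, map_zpow₀, hπ, hwπ]
instance {K : Type*} [Field K] (v : Valuation K ℤᵐ⁰) : Valued (CompletionAt v) ℤᵐ⁰ :=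
  inferInstanceAs (Valued v.Completion ℤᵐ⁰)
theorem valued_completionAt_algebraMap {K : Type*} [Field K] (v : Valuation K ℤᵐ⁰) (x : K) :
    Valued.v (algebraMap K (CompletionAt v) x) = v x :=
  Valued.valuedCompletion_apply (K := WithVal v) _
instance {K : Type*} [Field K] (v : Valuation K ℤᵐ⁰) : CompleteSpace (CompletionAt v) :=
  inferInstanceAs (CompleteSpace v.Completion)
theorem nonempty_rankOne_completionAt {K : Type*} [Field K] {v : Valuation K ℤᵐ⁰}
    (hv : Function.Surjective v) :
    Nonempty (Valued.v : Valuation (CompletionAt v) ℤᵐ⁰).RankOne := by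
  have : (Valued.v : Valuation (CompletionAt v) ℤᵐ⁰).IsNontrivial := by
    obtain ⟨x, hx⟩ := hv (WithZero.exp 1)
    refine ⟨algebraMap K _ x, ?_, ?_⟩
    · rw [valued_completionAt_algebraMap, hx]
      exact WithZero.exp_ne_zero
    · rw [valued_completionAt_algebraMap, hx, ← WithZero.exp_zero]
      exact fun h ↦ one_ne_zero (WithZero.exp_injective h)
  rw [Valuation.nonempty_rankOne_iff_mulArchimedean]
  exact MulArchimedean.comap (MonoidWithZeroHom.ValueGroup₀.embedding).toMonoidHom
    MonoidWithZeroHom.ValueGroup₀.embedding_strictMono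
/-- The completion at a normalized discrete valuation as a normed field. The norm depends on the
choice of an embedding of the value group into the real numbers; only its topology matters. -/
@[reducible]
def completionNormedField {K : Type*} [Field K] {v : Valuation K ℤᵐ⁰}
    (hv : Function.Surjective v) : NontriviallyNormedField (CompletionAt v) :=
  letI := (nonempty_rankOne_completionAt hv).some
  Valued.toNontriviallyNormedField (L := CompletionAt v) (Γ₀ := ℤᵐ⁰)
theorem isUltrametricDist_completion {K : Type*} [Field K] {v : Valuation K ℤᵐ⁰}
    (hv : Function.Surjective v) :
    letI := completionNormedField hv
    IsUltrametricDist (CompletionAt v) := by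
  let := (nonempty_rankOne_completionAt hv).some
  exact Valued.instIsUltrametricDist (L := CompletionAt v) (Γ₀ := ℤᵐ⁰)
theorem norm_algebraMap_completion_lt_one_iff {K : Type*} [Field K] {v : Valuation K ℤᵐ⁰}
    (hv : Function.Surjective v) (x : K) :
    letI := completionNormedField hv
    ‖algebraMap K (CompletionAt v) x‖ < 1 ↔ v x < 1 := by
  let := (nonempty_rankOne_completionAt hv).some
  rw [← valued_completionAt_algebraMap]
  exact Valued.toNormedField.norm_lt_one_iff
theorem denseRange_algebraMap_completion {K : Type*} [Field K] (v : Valuation K ℤᵐ⁰) :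
    DenseRange (algebraMap K (CompletionAt v)) := by
  have h := UniformSpace.Completion.denseRange_coe (α := WithVal v)
  exact (h.comp (WithVal.equiv v).symm.surjective.denseRange
    (UniformSpace.Completion.continuous_coe _) : _)
/-- Simultaneous approximation at finitely many distinct discrete valuations. -/
theorem exists_near_of_valuations {K : Type*} [Field K]
    (T : Finset (Valuation K ℤᵐ⁰)) (hT : ∀ v ∈ T, Function.Surjective v)
    (z : ∀ v : T, CompletionAt v.1) (η : T → ℝ) (hη : ∀ v, 0 < η v) :
    ∃ x : K, ∀ v : T, letI := completionNormedField (hT v.1 v.2)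
      ‖algebraMap K (CompletionAt v.1) x - z v‖ < η v := by
  let (v : T) := completionNormedField (hT v.1 v.2)
  let a (v : T) : AbsoluteValue K ℝ :=
    (NormedField.toAbsoluteValue (CompletionAt v.1)).comp
      (algebraMap K (CompletionAt v.1)).injective
  have ha (v : T) (x : K) : a v x = ‖algebraMap K (CompletionAt v.1) x‖ := rfl
  have halt (v : T) (x : K) : a v x < 1 ↔ v.1 x < 1 :=
    norm_algebraMap_completion_lt_one_iff (hT v.1 v.2) x
  -- The given valuations define nontrivial, pairwise inequivalent absolute values on `K`, for which
  -- weak approximation is available after replacing the `z v` by elements `u v` of `K`.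
  have h1 (v : T) : (a v).IsNontrivial := by
    obtain ⟨x, hx⟩ := hT v.1 v.2 (WithZero.exp (-1))
    refine ⟨x, ?_, ((halt v x).2 ?_).ne⟩
    · rintro rfl
      rw [map_zero] at hx
      exact WithZero.exp_ne_zero hx.symm
    · rw [hx, ← WithZero.exp_zero]
      exact WithZero.exp_lt_exp.2 (by norm_num)
  have h2 : Pairwise fun i j ↦ ¬ (a i).IsEquiv (a j) := by
    intro v w hvw heq
    refine hvw (Subtype.ext (valuation_eq_of_lt_one_iff (hT v.1 v.2) (hT w.1 w.2) fun x ↦ ?_))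
    rw [← halt, ← halt, heq.lt_one_iff]
  have hz (v : T) : ∃ u : K, ‖algebraMap K (CompletionAt v.1) u - z v‖ < η v / 2 := by
    obtain ⟨u, hu⟩ := (denseRange_algebraMap_completion v.1).exists_dist_lt (z v) (half_pos (hη v))
    exact ⟨u, by rwa [dist_comm, dist_eq_norm] at hu⟩
  choose u hu using hz
  have hd := AbsoluteValue.denseRange_algebraMap_pi h1 h2
  have hopen : IsOpen {y : ∀ v : T, WithAbs (a v) |
      ∀ v, ‖y v - (WithAbs.equiv (a v)).symm (u v)‖ < η v / 2} := by
    simp only [Set.ofPred_forall]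
    refine isOpen_iInter_of_finite fun v ↦ isOpen_lt ?_ continuous_const
    fun_prop
  obtain ⟨x, hx⟩ := hd.exists_mem_open hopen ⟨fun v ↦ (WithAbs.equiv (a v)).symm (u v), fun v ↦ by
    simpa using half_pos (hη v)⟩
  refine ⟨x, fun v ↦ ?_⟩
  have h3 : ‖algebraMap K (CompletionAt v.1) (x - u v)‖ < η v / 2 := hx v
  rw [map_sub] at h3
  calc _ ≤ _ := norm_sub_le_norm_sub_add_norm_sub _ (algebraMap K (CompletionAt v.1) (u v)) _
    _ < η v := by linarith [hu v]

end WeakApproximation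

/-! ### Localization in the long exact sequence for discrete modules -/

section Cohomology
open Topology groupCohomology
variable {G : Type*} [Group G] [TopologicalSpace G] {M F P : Type*} [CommGroup M] [CommGroup F]
  [CommGroup P] [MulDistribMulAction G M] [MulDistribMulAction G F] [MulDistribMulAction G P]
theorem H1.exists_mk_eq (x : H1 G M) : ∃ c : Z1 G M, (QuotientGroup.mk c : Z1 G M ⧸ B1 G M) = x :=
  QuotientGroup.mk_surjective x
theorem H1.mk_eq_one_iff {c : Z1 G M} :
    (QuotientGroup.mk c : Z1 G M ⧸ B1 G M) = (1 : H1 G M) ↔ IsMulCoboundary₁ c.1 :=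
  QuotientGroup.eq_one_iff c
theorem isLocallyConstant_smul_div [IsTopologicalGroup G] {m : M}
    (hm : ∀ᶠ g in 𝓝 (1 : G), g • m = m) : IsLocallyConstant fun g : G ↦ g • m / m := by
  refine (IsLocallyConstant.iff_eventually_eq _).2 fun g ↦ ?_
  rw [← map_mul_left_nhds_one g, Filter.eventually_map]
  filter_upwards [hm] with h hh
  rw [mul_smul, hh]
omit [TopologicalSpace G] in
theorem isMulCocycle₁_smul_div (m : M) : IsMulCocycle₁ fun g : G ↦ g • m / m := fun x y ↦ by
  simp only [smul_div', mul_smul, div_mul_div_cancel]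
/-- A short exact sequence `1 → M → F → P → 1` of modules under the topological group `G`, with `F`
discrete. -/
structure IsDiscreteExact (G : Type*) [Group G] [TopologicalSpace G] {M F P : Type*} [CommGroup M]
    [CommGroup F] [CommGroup P] [MulDistribMulAction G M] [MulDistribMulAction G F]
    [MulDistribMulAction G P] (i : M →* F) (q : F →* P) : Prop where
  smul_left : ∀ (g : G) m, i (g • m) = g • i m
  smul_right : ∀ (g : G) f, q (g • f) = g • q f
  injective : Function.Injective i
  apply_apply : ∀ m, q (i m) = 1
  exists_eq : ∀ f, q f = 1 → ∃ m, i m = f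
  surjective : Function.Surjective q
  eventually_smul_eq : ∀ f : F, ∀ᶠ g in 𝓝 (1 : G), g • f = f
variable {i : M →* F} {q : F →* P}
/-- A cocycle with values in `F` whose image in `P` is trivial comes from a cocycle with values in
`M`. -/
theorem IsDiscreteExact.exists_cocycle (h : IsDiscreteExact G i q) {c : G → F}
    (hc : IsMulCocycle₁ c) (hc' : IsLocallyConstant c) (hq : ∀ g, q (c g) = 1) :
    ∃ c' : Z1 G M, ∀ g, i (c'.1 g) = c g := by
  choose c' hc'c using fun g ↦ h.exists_eq (c g) (hq g)
  refine ⟨⟨c', fun x y ↦ h.injective ?_, ?_⟩, hc'c⟩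
  · rw [map_mul, h.smul_left, hc'c, hc'c, hc'c, hc x y]
  · refine IsLocallyConstant.desc c' i ?_ h.injective
    convert hc'
    exact funext hc'c
theorem IsDiscreteExact.exists_cocycle_of_fixed [IsTopologicalGroup G] (h : IsDiscreteExact G i q)
    {f : F} (hf : ∀ g : G, g • q f = q f) : ∃ c : Z1 G M, ∀ g, i (c.1 g) = g • f / f := by
  refine h.exists_cocycle (isMulCocycle₁_smul_div f)
    (isLocallyConstant_smul_div (h.eventually_smul_eq f)) fun g ↦ ?_
  rw [map_div, h.smul_right, hf, div_self']
/-- If `H¹(G, P)` vanishes, then `H¹(G, M) → H¹(G, F)` is surjective. -/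
theorem IsDiscreteExact.map_surjective [IsTopologicalGroup G] (h : IsDiscreteExact G i q)
    (hP : ∀ c : Z1 G P, IsMulCoboundary₁ c.1) :
    Function.Surjective (H1.map (.id G) i h.smul_left) := by
  intro x
  obtain ⟨c, rfl⟩ := x.exists_mk_eq
  obtain ⟨y, hy⟩ := hP (Z1.map (.id G) q h.smul_right c)
  obtain ⟨f, rfl⟩ := h.surjective y
  let cf : Z1 G F := ⟨fun g ↦ g • f / f, isMulCocycle₁_smul_div f,
    isLocallyConstant_smul_div (h.eventually_smul_eq f)⟩
  obtain ⟨c', hc'⟩ := h.exists_cocycle (c / cf).2.1 (c / cf).2.2 fun g ↦ by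
    have := hy g
    change q (c.1 g / (g • f / f)) = 1
    rw [map_div, map_div, h.smul_right, this]
    exact div_self' _
  refine ⟨(QuotientGroup.mk c' : Z1 G M ⧸ B1 G M), ?_⟩
  refine (QuotientGroup.eq_iff_div_mem (N := B1 G F)).2 ⟨f⁻¹, fun g ↦ ?_⟩
  change _ = i (c'.1 g) / c.1 g
  rw [hc']
  change _ = c.1 g / (g • f / f) / c.1 g
  rw [smul_inv', inv_div_inv, div_div_cancel_left, inv_div]
/-- A family of classes with values in the `M' v` that becomes the localization of a class in
`H¹(G, F)` is the localization of a class in `H¹(G, M)`, provided that `H¹(G, P)` vanishes and that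
every family of fixed points of the `P' v` agrees with a fixed point of `P` up to the images of
fixed points of the `F' v`. -/
theorem IsDiscreteExact.exists_map_eq [IsTopologicalGroup G] (h : IsDiscreteExact G i q)
    (hP : ∀ c : Z1 G P, IsMulCoboundary₁ c.1)
    {T : Type*} {G' M' F' P' : T → Type*} [∀ v, Group (G' v)] [∀ v, TopologicalSpace (G' v)]
    [∀ v, CommGroup (M' v)] [∀ v, CommGroup (F' v)] [∀ v, CommGroup (P' v)]
    [∀ v, MulDistribMulAction (G' v) (M' v)] [∀ v, MulDistribMulAction (G' v) (F' v)]
    [∀ v, MulDistribMulAction (G' v) (P' v)]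
    {i' : ∀ v, M' v →* F' v} {q' : ∀ v, F' v →* P' v}
    (h' : ∀ v, IsDiscreteExact (G' v) (i' v) (q' v))
    (φ : ∀ v, G' v →ₜ* G) {rM : ∀ v, M →* M' v} {rF : ∀ v, F →* F' v} {rP : ∀ v, P →* P' v}
    (hM : ∀ v g m, rM v (φ v g • m) = g • rM v m) (hF : ∀ v g f, rF v (φ v g • f) = g • rF v f)
    (hi : ∀ v m, i' v (rM v m) = rF v (i m)) (hq : ∀ v f, q' v (rF v f) = rP v (q f))
    (happrox : ∀ p : ∀ v, P' v, (∀ v (g : G' v), g • p v = p v) →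
      ∃ p₀ : P, (∀ g : G, g • p₀ = p₀) ∧ ∀ v, ∃ f : F' v, (∀ g : G' v, g • f = f) ∧
        q' v f = rP v p₀ / p v)
    (x : ∀ v, H1 (G' v) (M' v)) (y : H1 G F)
    (hxy : ∀ v, H1.map (.id _) (i' v) (h' v).smul_left (x v) = H1.map (φ v) (rF v) (hF v) y) :
    ∃ z : H1 G M, ∀ v, H1.map (φ v) (rM v) (hM v) z = x v := by
  have hnat (v : T) (z : H1 G M) : H1.map (.id _) (i' v) (h' v).smul_left
      (H1.map (φ v) (rM v) (hM v) z) =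
        H1.map (φ v) (rF v) (hF v) (H1.map (.id G) i h.smul_left z) := by
    obtain ⟨c, rfl⟩ := z.exists_mk_eq
    refine congrArg (QuotientGroup.mk (s := B1 (G' v) (F' v))) (Subtype.ext (funext fun g ↦ ?_))
    exact hi v _
  obtain ⟨y, rfl⟩ := h.map_surjective hP y
  -- It suffices to treat classes that become trivial in `F`.
  suffices key : ∀ x : ∀ v, H1 (G' v) (M' v),
      (∀ v, H1.map (.id _) (i' v) (h' v).smul_left (x v) = 1) →
      ∃ z : H1 G M, ∀ v, H1.map (φ v) (rM v) (hM v) z = x v by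
    obtain ⟨z, hz⟩ := key (fun v ↦ x v / H1.map (φ v) (rM v) (hM v) y) fun v ↦ by
      rw [map_div, hxy, hnat, div_self']
    exact ⟨z * y, fun v ↦ by rw [map_mul, hz, div_mul_cancel]⟩
  intro x hx
  choose c hc using fun v ↦ (x v).exists_mk_eq
  have hcob (v : T) : ∃ f : F' v, ∀ g : G' v, g • f / f = i' v ((c v).1 g) := by
    have := hx v
    rw [← hc] at this
    exact H1.mk_eq_one_iff.1 this
  choose f hf using hcob
  -- The class `x v` is the image of the fixed point `q' v (f v)` under the connecting map; the
  -- required class is the image of an approximating fixed point `p₀`.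
  obtain ⟨p₀, hp₀, happ⟩ := happrox (fun v ↦ q' v (f v)) fun v g ↦ by
    rw [← (h' v).smul_right, ← div_eq_one, ← map_div, hf, (h' v).apply_apply]
  choose f' hf' hf'q using happ
  obtain ⟨f₀, rfl⟩ := h.surjective p₀
  obtain ⟨c₀, hc₀⟩ := h.exists_cocycle_of_fixed hp₀
  refine ⟨(QuotientGroup.mk c₀ : Z1 G M ⧸ B1 G M), fun v ↦ ?_⟩
  obtain ⟨m, hm⟩ := (h' v).exists_eq (rF v f₀ / (f v * f' v)) (by
    rw [map_div, map_mul, hf'q, hq, mul_div_cancel, div_self'])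
  rw [← hc]
  refine (QuotientGroup.eq_iff_div_mem (N := B1 (G' v) (M' v))).2 ⟨m, fun g ↦ (h' v).injective ?_⟩
  change _ = i' v (rM v (c₀.1 (φ v g)) / (c v).1 g)
  rw [map_div, map_div, (h' v).smul_left, hm, hi, hc₀, ← hf, map_div, hF, smul_div', smul_mul', hf']
  rw [div_div_div_comm, mul_div_mul_right_eq_div]

end Cohomology

/-! ### Exactness on points and approximation of rational points -/

section Approximation
open Topology
variable {K : Type*} [Field K] {A B C : Type*} [CommRing A] [CommRing B] [CommRing C]
  [HopfAlgebra K A] [HopfAlgebra K B] [HopfAlgebra K C]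
  [Coalgebra.IsCocomm K A] [Coalgebra.IsCocomm K B] [Coalgebra.IsCocomm K C]
  {i : B →ₐc[K] A} {q : C →ₐc[K] B}
  {E : Type*} [Field E] [Algebra K E] {I : Type*}
/-- The sequence of points over a separably closed field is exact. -/
theorem IsShortExact.isDiscreteExact_points [Normal K E] (h : IsShortExact i q)
    (hB : IsDiagonalizableOver K B E) (hC : IsDiagonalizableOver K C E)
    [Module.Finite ℤ (Additive (CharGroup K B E))]
    (b : Module.Basis I ℤ (Additive (CharGroup K C E)))
    {s : CharGroup K B E →* CharGroup K C E} {d : ℕ} (hd : (d : K) ≠ 0)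
    (hs : ∀ x, s (charMap E q x) = x ^ d)
    {L Ω : Type*} [Field L] [Field Ω] [Algebra K L] [Algebra L Ω] [Algebra K Ω]
    [IsScalarTower K L Ω] [Algebra.IsAlgebraic L Ω] [IsSepClosed Ω] (ι : E →ₐ[K] Ω) :
    IsDiscreteExact Gal(Ω/L) (Points.comap K Ω i) (Points.comap K Ω q) where
  smul_left _ _ := rfl
  smul_right _ _ := rfl
  injective := h.comap_injective Ω
  apply_apply := h.comap_comap Ω
  exists_eq _ := h.exists_comap_eq
  surjective := comap_surjective_of_isSepClosed hB hC b hd hs ι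
  eventually_smul_eq := eventually_smul_eq ι hB
omit [Coalgebra.IsCocomm K C] in
/-- A basis of characters permuted by the Galois group of `E / K` is permuted by the Galois group
of every extension. -/
theorem isPermBasis_compHom [Normal K E] {L Ω : Type*} [Field L] [Field Ω] [Algebra K L]
    [Algebra L Ω] [Algebra K Ω] [IsScalarTower K L Ω] (ι : E →ₐ[K] Ω) [MulAction Gal(E/K) I]
    {b : Module.Basis I ℤ (Additive (CharGroup K C E))}
    (hb : ∀ (σ : Gal(E/K)) (j : I), Algebra.TensorProduct.map (σ : E →ₐ[K] E) (AlgHom.id K C)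
      (b j).toMul.val = (b (σ • j)).toMul.val) :
    letI := MulAction.compHom I (galRes (L := L) ι : Gal(Ω/L) →* Gal(E/K))
    IsPermBasis L ι b :=
  fun τ j ↦ hb (galRes ι τ) j
theorem charEval_map {Ω : Type*} [Field Ω] [Algebra K Ω] (ι : E →ₐ[K] Ω) (p : Points K C E)
    (x : CharGroup K C E) :
    charEval C ι (Points.map K C ι p) x = ι (charEval C (AlgHom.id K E) p x) :=
  evalAt_map (AlgHom.id K E) ι p x.val
theorem galRes_id {E : Type*} [Field E] [Algebra K E] [Normal K E] (σ : Gal(E/K)) :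
    galRes (AlgHom.id K E) σ = σ :=
  AlgEquiv.ext fun x ↦ galRes_apply (AlgHom.id K E) σ x
omit [Coalgebra.IsCocomm K C] in
theorem isPermBasis_id [Normal K E] [MulAction Gal(E/K) I]
    {b : Module.Basis I ℤ (Additive (CharGroup K C E))}
    (hb : ∀ (σ : Gal(E/K)) (j : I), Algebra.TensorProduct.map (σ : E →ₐ[K] E) (AlgHom.id K C)
      (b j).toMul.val = (b (σ • j)).toMul.val) :
    IsPermBasis K (AlgHom.id K E) b := fun σ j ↦ by
  rw [galRes_id]
  exact hb σ j
/-- The first cohomology group of a quasi-trivial torus vanishes over every extension field. -/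
theorem isMulCoboundary_of_perm [Normal K E] {L Ω : Type*} [Field L] [Field Ω] [Algebra K L]
    [Algebra L Ω] [Algebra K Ω] [IsScalarTower K L Ω] [Normal L Ω] (ι : E →ₐ[K] Ω)
    (hC : IsDiagonalizableOver K C E) [Finite I] [MulAction Gal(E/K) I]
    {b : Module.Basis I ℤ (Additive (CharGroup K C E))}
    (hb : ∀ (σ : Gal(E/K)) (j : I), Algebra.TensorProduct.map (σ : E →ₐ[K] E) (AlgHom.id K C)
      (b j).toMul.val = (b (σ • j)).toMul.val)
    (c : Z1 Gal(Ω/L) (Points K C Ω)) : groupCohomology.IsMulCoboundary₁ c.1 := by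
  let := MulAction.compHom I (galRes (L := L) ι : Gal(Ω/L) →* Gal(E/K))
  exact (isPermBasis_compHom ι hb).isMulCoboundary hC c
/-- The points over `K` whose coordinates with respect to a Galois-fixed basis are close to those
of a given point over a complete field `k` differ from it by the image of a rational point. -/
theorem exists_pos_forall_near [IsGalois K E] {k Ω : Type*} [NontriviallyNormedField k]
    [CompleteSpace k] [IsUltrametricDist k] [Field Ω] [Algebra K k] [Algebra k Ω] [Algebra K Ω]
    [IsScalarTower K k Ω] [IsGalois k Ω] (ι : E →ₐ[K] Ω)
    (hB : IsDiagonalizableOver K B E) (hC : IsDiagonalizableOver K C E)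
    [Module.Finite ℤ (Additive (CharGroup K B E))] [Fintype I] [DecidableEq I]
    [MulAction Gal(E/K) I]
    {b : Module.Basis I ℤ (Additive (CharGroup K C E))}
    (hb : ∀ (σ : Gal(E/K)) (j : I), Algebra.TensorProduct.map (σ : E →ₐ[K] E) (AlgHom.id K C)
      (b j).toMul.val = (b (σ • j)).toMul.val)
    {s : CharGroup K B E →* CharGroup K C E} {d : ℕ} (hd : (d : K) ≠ 0)
    (hs : ∀ x, s (charMap E q x) = x ^ d) {J : Type*} [Fintype J]
    {w : J → I → E} {c : I → J → E} (hc : ∀ (τ : Gal(E/K)) i m, τ (c i m) = c (τ • i) m)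
    (hcw : ∀ i i', ∑ m, c i m * w m i' = if i = i' then 1 else 0)
    {p : Points K C Ω} (hp : ∀ τ : Gal(Ω/k), τ • p = p) :
    ∃ (y : J → k) (η : ℝ), 0 < η ∧ ∀ x : J → K, (∀ m, ‖algebraMap K k (x m) - y m‖ < η) →
      (∀ i, ∑ m, algebraMap K E (x m) * w m i ≠ 0) ∧
      ∀ p₀ : Points K C E, (∀ τ : Gal(E/K), τ • p₀ = p₀) →
        (∀ i, charEval C (AlgHom.id K E) p₀ (b i).toMul = ∑ m, algebraMap K E (x m) * w m i) →
        ∃ f : Points K B Ω, (∀ τ : Gal(Ω/k), τ • f = f) ∧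
          Points.comap K Ω q f = Points.map K C ι p₀ / p := by
  let := MulAction.compHom I (galRes (L := k) ι : Gal(Ω/k) →* Gal(E/K))
  have hbv : IsPermBasis k ι b := isPermBasis_compHom ι hb
  obtain ⟨y, hy⟩ := exists_coords_of_fixed hc hcw ι
    (t := fun i ↦ charEval C ι p (b i).toMul) fun τ i ↦ by
      have := hbv.charEval_smul τ p (τ • i)
      rw [hp, inv_smul_smul] at this
      exact this.symm
  obtain ⟨η, hη, hnear⟩ := exists_fixed_lift_div_of_near (k := k) ι hB hC hbv
    hd hs (fun m i ↦ ι (w m i)) hp y hy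
  refine ⟨y, η, hη, fun x hx ↦ ?_⟩
  obtain ⟨h1, h2⟩ := hnear (fun m ↦ algebraMap K _ (x m)) hx
  have hmap (i : I) : ι (∑ m, algebraMap K E (x m) * w m i) =
      ∑ m, algebraMap k Ω (algebraMap K k (x m)) * ι (w m i) := by
    rw [map_sum]
    refine Finset.sum_congr rfl fun m _ ↦ ?_
    rw [map_mul, AlgHom.commutes, IsScalarTower.algebraMap_apply K k Ω]
  refine ⟨fun i h0 ↦ h1 i ?_, fun p₀ hp₀ hp₀x ↦ h2 _ (fun τ ↦ ?_) fun i ↦ ?_⟩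
  · rw [← hmap, h0, map_zero]
  · conv_rhs => rw [← hp₀ (galRes ι τ)]
    exact WithConv.ext (AlgHom.ext fun a ↦ (galRes_apply ι τ (p₀.ofConv a)).symm)
  · rw [charEval_map, hp₀x, hmap]
/-- Rational points of a quasi-trivial torus over finitely many completions are approximated by a
rational point over `K`, up to the images of rational points of the torus `Spec B`. -/
theorem exists_fixed_point_near [IsGalois K E] (T : Finset (Valuation K ℤᵐ⁰))
    (hT : ∀ v ∈ T, Function.Surjective v)
    (ι : ∀ v : T, E →ₐ[K] SeparableClosure (CompletionAt v.1))
    (hB : IsDiagonalizableOver K B E) (hC : IsDiagonalizableOver K C E)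
    [Module.Finite ℤ (Additive (CharGroup K B E))] [Finite I] [MulAction Gal(E/K) I]
    {b : Module.Basis I ℤ (Additive (CharGroup K C E))}
    (hb : ∀ (σ : Gal(E/K)) (j : I), Algebra.TensorProduct.map (σ : E →ₐ[K] E) (AlgHom.id K C)
      (b j).toMul.val = (b (σ • j)).toMul.val)
    {s : CharGroup K B E →* CharGroup K C E} {d : ℕ} (hd : (d : K) ≠ 0)
    (hs : ∀ x, s (charMap E q x) = x ^ d)
    (p : ∀ v : T, Points K C (SeparableClosure (CompletionAt v.1)))
    (hp : ∀ v, ∀ τ : Gal(SeparableClosure (CompletionAt v.1)/CompletionAt v.1), τ • p v = p v) :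
    ∃ p₀ : Points K C E, (∀ τ : Gal(E/K), τ • p₀ = p₀) ∧
      ∀ v, ∃ f : Points K B (SeparableClosure (CompletionAt v.1)),
        (∀ τ : Gal(SeparableClosure (CompletionAt v.1)/CompletionAt v.1), τ • f = f) ∧
        Points.comap K _ q f = Points.map K C (ι v) p₀ / p v := by
  classical
  have := Fintype.ofFinite I
  have hbK := isPermBasis_id hb
  -- A valuation in `T` is needed for the coordinates of the approximating point to be nonzero.
  rcases isEmpty_or_nonempty T with hTe | ⟨⟨v₀⟩⟩
  · exact ⟨1, fun τ ↦ smul_one τ, hTe.elim⟩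
  obtain ⟨n, w, c, hw, hc, hcw⟩ := exists_fixed_basis fun j ↦ hbK.eventually_smul_eq j
  have hloc (v : T) : ∃ (y : Fin n → CompletionAt v.1) (η : ℝ), 0 < η ∧ ∀ x : Fin n → K,
      (∀ m, letI := completionNormedField (hT v.1 v.2)
        ‖algebraMap K (CompletionAt v.1) (x m) - y m‖ < η) →
      (∀ i, ∑ m, algebraMap K E (x m) * w m i ≠ 0) ∧
      ∀ p₀ : Points K C E, (∀ τ : Gal(E/K), τ • p₀ = p₀) →
        (∀ i, charEval C (AlgHom.id K E) p₀ (b i).toMul = ∑ m, algebraMap K E (x m) * w m i) →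
        ∃ f : Points K B (SeparableClosure (CompletionAt v.1)),
          (∀ τ : Gal(SeparableClosure (CompletionAt v.1)/CompletionAt v.1), τ • f = f) ∧
          Points.comap K _ q f = Points.map K C (ι v) p₀ / p v := by
    let := completionNormedField (hT v.1 v.2)
    have := isUltrametricDist_completion (hT v.1 v.2)
    exact exists_pos_forall_near (k := CompletionAt v.1) (ι v) hB hC hb hd hs hc hcw (hp v)
  choose y η hη hnear using hloc
  choose x hx using fun m ↦ exists_near_of_valuations T hT (fun v ↦ y v m) η hη
  have h1 := (hnear v₀ x fun m ↦ hx m v₀).1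
  obtain ⟨p₀, hp₀⟩ := exists_point_of_basis hC b (AlgHom.id K E) fun i ↦ Units.mk0 _ (h1 i)
  have hfix (τ : Gal(E/K)) : τ • p₀ = p₀ := charEval_ext_of_basis hC b (AlgHom.id K E) fun i ↦ by
    rw [hbK.charEval_smul, hp₀, hp₀, Units.val_mk0, Units.val_mk0, map_sum]
    refine Finset.sum_congr rfl fun m _ ↦ ?_
    rw [map_mul, hw, smul_inv_smul, AlgEquiv.commutes]
  exact ⟨p₀, hfix, fun v ↦ (hnear v x fun m ↦ hx m v).2 p₀ hfix hp₀⟩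

end Approximation

end FlasqueGW

end

open FlasqueGW in
theorem mainTheorem7 {K : Type*} [Field K]
    {A B C : Type*} [CommRing A] [CommRing B] [CommRing C]
    [HopfAlgebra K A] [HopfAlgebra K B] [HopfAlgebra K C]
    [Coalgebra.IsCocomm K A] [Coalgebra.IsCocomm K B] [Coalgebra.IsCocomm K C]
    (i : B →ₐc[K] A) (q : C →ₐc[K] B) (hres : IsFlasqueResolution i q)
    (hsmooth : Algebra.Smooth K A)
    (T : Finset (Valuation K (WithZero (Multiplicative ℤ))))
    (hT : ∀ v ∈ T, Function.Surjective v)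
    (ι : ∀ v : T, SeparableClosure K →ₐ[K] SeparableClosure (CompletionAt v.1)) :
    ∃ e : LocCoker A T ι ≃* LocCoker B T ι,
      ∀ x : ∀ v : T, GalH1 K A (CompletionAt v.1),
        e (LocCoker.proj A T ι x) =
          LocCoker.proj B T ι (fun v ↦ GalH1.push K i (CompletionAt v.1) (x v)) := by
  obtain ⟨nB, ⟨eB⟩⟩ := hres.flasque.1
  obtain ⟨nC, ⟨eC⟩⟩ := hres.quasiTrivial.1
  obtain ⟨n, b, hb⟩ := hres.quasiTrivial.2
  have hB := isDiagonalizableOver_of_bialgEquiv eB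
  have hC := isDiagonalizableOver_of_bialgEquiv eC
  have : Module.Finite ℤ (Additive (Multiplicative (Fin nB → ℤ))) :=
    inferInstanceAs (Module.Finite ℤ (Fin nB → ℤ))
  have := finite_charGroup_of_bialgEquiv eB
  obtain ⟨s, d, hd, hs⟩ := hres.exact.exists_almost_retraction (SeparableClosure K) hB hC
  let := permAction b hb
  have hperm (σ : Gal(SeparableClosure K/K)) (j : Fin n) : Algebra.TensorProduct.map
      (σ : SeparableClosure K →ₐ[K] SeparableClosure K) (AlgHom.id K C) (b j).toMul.val =
        (b (σ • j)).toMul.val := tensorMap_permAction b hb σ j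
  have hK := hres.exact.isDiscreteExact_points (L := K) hB hC b hd hs
    (AlgHom.id K (SeparableClosure K))
  have hv (v : T) := hres.exact.isDiscreteExact_points (L := CompletionAt v.1) hB hC b hd hs (ι v)
  have hPK := isMulCoboundary_of_perm (L := K) (AlgHom.id K (SeparableClosure K)) hC hperm
  have hPv (v : T) := isMulCoboundary_of_perm (L := CompletionAt v.1) (ι v) hC hperm
  let Φ : (∀ v : T, GalH1 K A (CompletionAt v.1)) →* ∀ v : T, GalH1 K B (CompletionAt v.1) :=
    MonoidHom.piMap fun v ↦ GalH1.push K i (CompletionAt v.1)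
  have hnat (z : GalH1 K A K) :
      Φ (localization A T ι z) = localization B T ι (GalH1.push K i K z) := by
    obtain ⟨c, rfl⟩ := H1.exists_mk_eq z
    rfl
  let Ψ : LocCoker A T ι →* LocCoker B T ι := QuotientGroup.map _ _ Φ (by
    rintro _ ⟨z, rfl⟩
    exact ⟨_, (hnat z).symm⟩)
  refine ⟨MulEquiv.ofBijective Ψ ⟨?_, ?_⟩, fun x ↦ rfl⟩
  · rw [injective_iff_map_eq_one]
    intro x hx
    obtain ⟨x, rfl⟩ := QuotientGroup.mk_surjective x
    obtain ⟨y, hy⟩ := (QuotientGroup.eq_one_iff (Φ x)).1 hx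
    obtain ⟨z, hz⟩ := hK.exists_map_eq hPK hv (fun v ↦ galRes (ι v))
      (rM := fun v ↦ Points.map K A (ι v)) (rF := fun v ↦ Points.map K B (ι v))
      (rP := fun v ↦ Points.map K C (ι v))
      (fun v σ f ↦ WithConv.ext (AlgHom.ext fun a ↦ galRes_apply (ι v) σ (f.ofConv a)))
      (fun v σ f ↦ WithConv.ext (AlgHom.ext fun a ↦ galRes_apply (ι v) σ (f.ofConv a)))
      (fun _ _ ↦ rfl) (fun _ _ ↦ rfl)
      (exists_fixed_point_near T hT ι hB hC hperm hd hs) x y fun v ↦ (congrFun hy v).symm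
    exact (QuotientGroup.eq_one_iff x).2 ⟨z, funext hz⟩
  · intro y
    obtain ⟨y, rfl⟩ := QuotientGroup.mk_surjective y
    choose x hx using fun v ↦ (hv v).map_surjective (hPv v) (y v)
    exact ⟨(QuotientGroup.mk x : LocCoker A T ι), congrArg (LocCoker.proj B T ι) (funext hx)⟩
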